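/- Let $n\ge 2$, let $p,q\in(1,\infty)$ with $p\ne q$, and let $\Omega\subset\mathbb{R}^n$ be a bounded domain (a non-empty, open, connected, bounded set). For a function $v$ on $\Omega$ for which $v^+=\max\{v,0\}$ and $v^-=-\min\{v,0\}$ have weak gradients in $L^1_{\mathrm{loc}}(\Omega)$ (in particular for every $v\in W^{1,1}(\Omega)$) put $$J_{p,q}(v,\Omega)=\int_\Omega\bigl(|\nabla v^+|^p+|\nabla v^-|^q\bigr)\,dx\in[0,\infty].$$ Let $\varphi\in W^{1,p}(\Omega)\cup W^{1,q}(\Omega)$ be such that $J_{p,q}(\varphi,\Omega)<\infty$. Then there exists $u\in\varphi+\bigl(W^{1,p}_0(\Omega)\cup W^{1,q}_0(\Omega)\bigr)$ such that $J_{p,q}(u,\Omega)<\infty$ and $$J_{p,q}(u,\Omega)\le J_{p,q}(v,\Omega)\qquad\text{for every } v\in\varphi+\bigl(W^{1,p}_0(\Omega)\cup W^{1,q}_0(\Omega)\bigr).$$ Here $W^{1,r}_0(\Omega)$ denotes the closure of $C_c^\infty(\Omega)$ in $W^{1,r}(\Omega)$. -/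

import Mathlib

open MeasureTheory Filter Topology
open scoped ContDiff ENNReal

namespace TwoPhase

/-- `η` belongs to `C_c^∞(Ω)`: it is smooth with compact support contained in `Ω`. -/
structure IsTestFunction {n : ℕ} (Ω : Set (EuclideanSpace ℝ (Fin n)))
    (η : EuclideanSpace ℝ (Fin n) → ℝ) : Prop where
  contDiff : ContDiff ℝ ∞ η
  hasCompactSupport : HasCompactSupport η
  tsupport_subset : tsupport η ⊆ Ω

/-- `G` is a weak (distributional) gradient of `f` in `Ω`: both are in `L^1_loc(Ω)`, and
`∫_Ω f ∇η = - ∫_Ω η G` for all `η ∈ C_c^∞(Ω)`. -/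
structure HasWeakGradient {n : ℕ} (Ω : Set (EuclideanSpace ℝ (Fin n)))
    (f : EuclideanSpace ℝ (Fin n) → ℝ)
    (G : EuclideanSpace ℝ (Fin n) → EuclideanSpace ℝ (Fin n)) : Prop where
  locallyIntegrableOn : LocallyIntegrableOn f Ω volume
  locallyIntegrableOn_grad : LocallyIntegrableOn G Ω volume
  integral_eq : ∀ η : EuclideanSpace ℝ (Fin n) → ℝ, IsTestFunction Ω η →
    ∫ x in Ω, f x • gradient η x = - ∫ x in Ω, η x • G x

/-- On an open set the weak gradient is unique up to null sets. -/
theorem HasWeakGradient.ae_eq {n : ℕ} {Ω : Set (EuclideanSpace ℝ (Fin n))} (hΩ : IsOpen Ω)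
    {f : EuclideanSpace ℝ (Fin n) → ℝ}
    {G H : EuclideanSpace ℝ (Fin n) → EuclideanSpace ℝ (Fin n)}
    (hG : HasWeakGradient Ω f G) (hH : HasWeakGradient Ω f H) :
    G =ᵐ[volume.restrict Ω] H := by
  have key : ∀ᵐ x ∂volume, x ∈ Ω → (G - H) x = 0 := by
    refine hΩ.ae_eq_zero_of_integral_contDiff_smul_eq_zero
      (hG.locallyIntegrableOn_grad.sub hH.locallyIntegrableOn_grad) ?_
    intro η h1 h2 h3
    have hη : IsTestFunction Ω η := ⟨h1, h2, h3⟩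
    have hint : ∀ K : EuclideanSpace ℝ (Fin n) → EuclideanSpace ℝ (Fin n),
        LocallyIntegrableOn K Ω volume → Integrable (fun x => η x • K x) volume := by
      intro K hK
      have hKi : IntegrableOn K (tsupport η) volume :=
        hK.integrableOn_compact_subset h3 h2
      have : IntegrableOn (fun x => η x • K x) (tsupport η) volume :=
        hKi.continuousOn_smul h1.continuous.continuousOn h2
      refine (integrableOn_iff_integrable_of_support_subset ?_).1 this
      intro x hx
      apply subset_tsupport η
      intro h0
      simp [h0] at hx
    have hset : ∀ K : EuclideanSpace ℝ (Fin n) → EuclideanSpace ℝ (Fin n),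
        ∫ x in Ω, η x • K x = ∫ x, η x • K x := by
      intro K
      refine setIntegral_eq_integral_of_forall_compl_eq_zero ?_
      intro x hx
      have : η x = 0 := by
        by_contra h0
        exact hx (h3 (subset_tsupport η h0))
      simp [this]
    have e := (hG.integral_eq η hη).symm.trans (hH.integral_eq η hη)
    rw [hset, hset, neg_inj] at e
    have : (fun x => η x • (G - H) x) = fun x => η x • G x - η x • H x := by
      funext x
      simp [smul_sub]
    rw [this, integral_sub (hint G hG.locallyIntegrableOn_grad)
      (hint H hH.locallyIntegrableOn_grad), e, sub_self]
  rw [Filter.EventuallyEq, ae_restrict_iff' hΩ.measurableSet]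
  filter_upwards [key] with x hx hxΩ
  exact sub_eq_zero.1 (hx hxΩ)

open Classical in
/-- The weak gradient `∇f` of `f` in `Ω`, as a function determined up to null sets of `Ω`. (It is
the zero function if `f` has no weak gradient in `Ω`.) -/
noncomputable def weakGradient {n : ℕ} (Ω : Set (EuclideanSpace ℝ (Fin n)))
    (f : EuclideanSpace ℝ (Fin n) → ℝ) :
    EuclideanSpace ℝ (Fin n) → EuclideanSpace ℝ (Fin n) :=
  if h : ∃ G, HasWeakGradient Ω f G then h.choose else 0

/-- The Sobolev space `W^{1,p}(Ω)`, as a set of representatives: `f ∈ L^p(Ω)` has a weak gradient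
in `L^p(Ω)`. Values outside `Ω` are irrelevant. -/
def sobolevSpace {n : ℕ} (p : ℝ) (Ω : Set (EuclideanSpace ℝ (Fin n))) :
    Set (EuclideanSpace ℝ (Fin n) → ℝ) :=
  {f | MemLp f (ENNReal.ofReal p) (volume.restrict Ω) ∧
    ∃ G, HasWeakGradient Ω f G ∧ MemLp G (ENNReal.ofReal p) (volume.restrict Ω)}

/-- `W_0^{1,p}(Ω)`: the closure of `C_c^∞(Ω)` in `W^{1,p}(Ω)`. -/
def sobolevSpaceZero {n : ℕ} (p : ℝ) (Ω : Set (EuclideanSpace ℝ (Fin n))) :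
    Set (EuclideanSpace ℝ (Fin n) → ℝ) :=
  {f | f ∈ sobolevSpace p Ω ∧
    ∃ η : ℕ → EuclideanSpace ℝ (Fin n) → ℝ, (∀ k, IsTestFunction Ω (η k)) ∧
      Tendsto (fun k => eLpNorm (fun x => f x - η k x)
        (ENNReal.ofReal p) (volume.restrict Ω)) atTop (𝓝 0) ∧
      Tendsto (fun k => eLpNorm (fun x => weakGradient Ω f x - gradient (η k) x)
        (ENNReal.ofReal p) (volume.restrict Ω)) atTop (𝓝 0)}

/-- `J_{p,q}(v,Ω) = ∫_Ω (|∇v⁺|^p + |∇v⁻|^q) dx ∈ [0,∞]`, for `v` in (at least) `W^{1,1}_loc(Ω)`,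
where `v⁺ = max{v,0}` and `v⁻ = -min{v,0}`. -/
noncomputable def energy {n : ℕ} (p q : ℝ) (v : EuclideanSpace ℝ (Fin n) → ℝ)
    (Ω : Set (EuclideanSpace ℝ (Fin n))) : ℝ≥0∞ :=
  ∫⁻ x in Ω, (‖weakGradient Ω (fun y => max (v y) 0) x‖ₑ ^ p +
    ‖weakGradient Ω (fun y => -min (v y) 0) x‖ₑ ^ q)

/-- The affine class `φ + (W_0^{1,p}(Ω) ∪ W_0^{1,q}(Ω))`. -/
def admissibleClass {n : ℕ} (p q : ℝ) (φ : EuclideanSpace ℝ (Fin n) → ℝ)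
    (Ω : Set (EuclideanSpace ℝ (Fin n))) : Set (EuclideanSpace ℝ (Fin n) → ℝ) :=
  {v | v - φ ∈ sobolevSpaceZero p Ω ∪ sobolevSpaceZero q Ω}

end TwoPhase

/-! Put m = min(p, q). On a bounded set a larger exponent gives a smaller Sobolev space, so the
admissible class is the affine space φ + W₀^{1,m}(Ω), and the direct method applies. Along a
minimizing sequence v_k the gradients of v_k⁺ are bounded in L^p and those of v_k⁻ in L^q. Hence
∇(v_k - φ) is bounded in L^m, and Rellich compactness
(`exists_subseq_tendsto_of_mem_sobolevSpaceZero`) gives a subsequence that converges in L^m to some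
u. Since truncation is 1-Lipschitz, v_k^± → u^± in L^m as well.

The difficulty is lower semicontinuity: v ↦ v^± is not linear, and the energy need not be convex in
v. The remedy is to forget that the two parts come from one function. Quadruples (a, b, ∇a, ∇b) with
∇a ∈ L^p, ∇b ∈ L^q and a - b - φ ∈ W₀^{1,m} form a convex set, on which ∫|∇a|^p + ∫|∇b|^q is convex.
Let z_k almost minimize this relaxed energy over the convex hull of the k-th tail of the sequence.
The infima over the hulls increase to a finite limit, so passing to the midpoint of z_k and z_l
gains almost nothing, and uniform convexity of |·|^p and |·|^q makes the gradient entries converge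
strongly in L^p and L^q. The function entries still tend to u⁺ and u⁻, because L^m balls are convex.
Weak gradients are closed under such limits, so the limits are ∇u⁺ and ∇u⁻; the energy bound and the
boundary condition pass to u (`energy_le_of_tendsto`). No weak compactness is needed.

Two classical facts are proved on the way. Positive parts are weakly differentiable
(`HasWeakGradient.posPart`), by mollification and smooth approximation of t ↦ max(t, 0). Rellich
compactness rests on ‖η(· + h) - η‖_p ≤ |h| ‖∇η‖_p: averages over small balls are uniformly close to
η, and for each fixed radius they form a bounded, equi-Lipschitz family. -/

namespace TwoPhase

open scoped Convolution

/-! ### Mollification in L¹ -/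

/-- Almost everywhere convergence together with a bound on the `L¹` norms by that of the limit
implies convergence in `L¹`. -/
theorem tendsto_integral_norm_sub_of_ae_tendsto {α F : Type*} [MeasurableSpace α] {μ : Measure α}
    [NormedAddCommGroup F] {f : ℕ → α → F} {g : α → F} (hf : ∀ k, Integrable (f k) μ)
    (hg : Integrable g μ) (hle : ∀ k, ∫ x, ‖f k x‖ ∂μ ≤ ∫ x, ‖g x‖ ∂μ)
    (hlim : ∀ᵐ x ∂μ, Tendsto (fun k => f k x) atTop (𝓝 (g x))) :
    Tendsto (fun k => ∫ x, ‖f k x - g x‖ ∂μ) atTop (𝓝 0) := by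
  have hsub : ∀ k, Integrable (fun x => ‖f k x - g x‖) μ := fun k => ((hf k).sub hg).norm
  -- The integrand is bounded by 2‖g‖ in absolute value and tends to 0 almost everywhere. Its
  -- integral is ∫‖f k - g‖ plus ∫‖g‖ - ∫‖f k‖, and the latter is nonnegative by `hle`.
  have key : Tendsto (fun k => ∫ x, (‖g x‖ + ‖f k x - g x‖ - ‖f k x‖) ∂μ) atTop
      (𝓝 (∫ _, (0 : ℝ) ∂μ)) := by
    refine tendsto_integral_of_dominated_convergence (fun x => 2 * ‖g x‖)
      (fun k => ((hg.norm.add (hsub k)).sub (hf k).norm).aestronglyMeasurable)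
      (hg.norm.const_mul 2) ?_ ?_
    · intro k
      filter_upwards with x
      rw [Real.norm_eq_abs, abs_le]
      constructor
      · have := norm_sub_norm_le (f k x) (g x)
        nlinarith [norm_nonneg (g x)]
      · have := norm_sub_le (f k x) (g x)
        linarith
    · filter_upwards [hlim] with x hx
      have h1 : Tendsto (fun k => ‖f k x - g x‖) atTop (𝓝 0) := by
        simpa using (hx.sub_const (g x)).norm
      simpa using (h1.const_add ‖g x‖).sub hx.norm
  rw [integral_zero] at key
  refine squeeze_zero (fun k => integral_nonneg fun x => norm_nonneg _) (fun k => ?_) key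
  have : ∫ x, (‖g x‖ + ‖f k x - g x‖ - ‖f k x‖) ∂μ
      = (∫ x, ‖g x‖ ∂μ) + (∫ x, ‖f k x - g x‖ ∂μ) - ∫ x, ‖f k x‖ ∂μ := by
    have h1 : Integrable (fun x => ‖g x‖ + ‖f k x - g x‖) μ := hg.norm.add (hsub k)
    rw [integral_sub h1 (hf k).norm, integral_add hg.norm (hsub k)]
  rw [this]
  linarith [hle k]

/-- Convolution with a nonnegative kernel of mass one does not increase the `L¹` norm. -/
theorem integral_norm_normed_convolution_le {n : ℕ} {F : Type*} [NormedAddCommGroup F]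
    [NormedSpace ℝ F] [CompleteSpace F] (ψ : ContDiffBump (0 : EuclideanSpace ℝ (Fin n)))
    {g : EuclideanSpace ℝ (Fin n) → F} (hg : Integrable g) :
    ∫ x, ‖(ψ.normed volume ⋆[ContinuousLinearMap.lsmul ℝ ℝ, volume] g) x‖ ≤ ∫ x, ‖g x‖ := by
  have hψ : Integrable (ψ.normed volume) := ψ.integrable_normed
  have h1 := hψ.integrable_convolution (ContinuousLinearMap.lsmul ℝ ℝ) hg.norm
  have h2 := hψ.integrable_convolution (ContinuousLinearMap.lsmul ℝ ℝ : ℝ →L[ℝ] F →L[ℝ] F) hg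
  calc ∫ x, ‖(ψ.normed volume ⋆[ContinuousLinearMap.lsmul ℝ ℝ, volume] g) x‖
      ≤ ∫ x, (ψ.normed volume ⋆[ContinuousLinearMap.lsmul ℝ ℝ, volume] fun y => ‖g y‖) x := by
        refine integral_mono h2.norm h1 fun x => ?_
        rw [convolution_def, convolution_def]
        refine (norm_integral_le_integral_norm _).trans (le_of_eq ?_)
        congr 1
        funext t
        simp [norm_smul, abs_of_nonneg (ψ.nonneg_normed (μ := volume) t)]
    _ = ∫ x, ‖g x‖ := by
        rw [integral_convolution (ContinuousLinearMap.lsmul ℝ ℝ) hψ hg.norm]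
        simp [ψ.integral_normed]

/-- A sequence of bump functions that concentrate at the origin. -/
noncomputable def shrinkingBump (n : ℕ) (k : ℕ) : ContDiffBump (0 : EuclideanSpace ℝ (Fin n)) where
  rIn := 1 / (k + 1)
  rOut := 2 / (k + 1)
  rIn_pos := by positivity
  rIn_lt_rOut := by gcongr; norm_num

theorem tendsto_shrinkingBump_rOut (n : ℕ) :
    Tendsto (fun k => (shrinkingBump n k).rOut) atTop (𝓝 0) := by
  have := (tendsto_one_div_add_atTop_nhds_zero_nat (𝕜 := ℝ)).const_mul 2
  simpa [shrinkingBump, div_eq_mul_inv] using this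

/-- Lebesgue differentiation gives convergence almost everywhere, and averaging does not increase
the L¹ norm; together these upgrade to convergence in L¹ without any density argument. -/
theorem tendsto_integral_norm_convolution_sub {n : ℕ} {F : Type*} [NormedAddCommGroup F]
    [NormedSpace ℝ F] [CompleteSpace F] {g : EuclideanSpace ℝ (Fin n) → F} (hg : Integrable g) :
    Tendsto (fun k => ∫ x, ‖((shrinkingBump n k).normed volume
      ⋆[ContinuousLinearMap.lsmul ℝ ℝ, volume] g) x - g x‖) atTop (𝓝 0) := by
  refine tendsto_integral_norm_sub_of_ae_tendsto (fun k => ?_) hg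
    (fun k => integral_norm_normed_convolution_le _ hg) ?_
  · exact ((shrinkingBump n k).integrable_normed (μ := volume)).integrable_convolution
      (ContinuousLinearMap.lsmul ℝ ℝ : ℝ →L[ℝ] F →L[ℝ] F) hg
  -- Lebesgue differentiation asks for a bounded ratio of outer to inner radius; here it equals 2
  -- for every `k`.
  · refine ContDiffBump.ae_convolution_tendsto_right_of_locallyIntegrable (K := 2)
      (tendsto_shrinkingBump_rOut n) (Eventually.of_forall fun k => ?_) hg.locallyIntegrable
    simp [shrinkingBump, div_eq_mul_inv]

/-- Mollification commutes with the weak gradient away from the boundary. -/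
theorem HasWeakGradient.hasGradientAt_convolution {n : ℕ} {Ω : Set (EuclideanSpace ℝ (Fin n))}
    {f : EuclideanSpace ℝ (Fin n) → ℝ} {G : EuclideanSpace ℝ (Fin n) → EuclideanSpace ℝ (Fin n)}
    (h : HasWeakGradient Ω f G) {L : Set (EuclideanSpace ℝ (Fin n))} (hL : IsCompact L)
    (hLΩ : L ⊆ Ω) (ψ : ContDiffBump (0 : EuclideanSpace ℝ (Fin n)))
    {x : EuclideanSpace ℝ (Fin n)} (hx : Metric.closedBall x ψ.rOut ⊆ L) :
    HasGradientAt (ψ.normed volume ⋆[ContinuousLinearMap.lsmul ℝ ℝ, volume] L.indicator f)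
      ((ψ.normed volume ⋆[ContinuousLinearMap.lsmul ℝ ℝ, volume] L.indicator G) x) x := by
  set ρ := ψ.normed volume with hρ
  have hρs : ContDiff ℝ ∞ ρ := ψ.contDiff_normed
  have hρc : HasCompactSupport ρ := ψ.hasCompactSupport_normed
  have hf : Integrable (L.indicator f) :=
    (h.locallyIntegrableOn.integrableOn_compact_subset hLΩ hL).integrable_indicator
      hL.measurableSet
  have hG : Integrable (L.indicator G) :=
    (h.locallyIntegrableOn_grad.integrableOn_compact_subset hLΩ hL).integrable_indicator
      hL.measurableSet
  have hsupp : ∀ t, t ∉ Metric.closedBall x ψ.rOut → x - t ∉ tsupport ρ := by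
    intro t ht h0
    rw [hρ, ψ.tsupport_normed_eq] at h0
    apply ht
    simpa [dist_eq_norm, norm_sub_rev] using h0
  -- The reflected kernel centred at `x` is an admissible test function because its support lies in
  -- the ball contained in `L`. The weak gradient identity for it is precisely the derivative
  -- formula for the convolution, and cutting off outside `L` is invisible to it.
  set η : EuclideanSpace ℝ (Fin n) → ℝ := fun t => ρ (x - t) with hη
  have hηs : tsupport η ⊆ L := by
    refine (closure_minimal ?_ Metric.isClosed_closedBall).trans hx
    intro t ht
    by_contra h0
    exact ht (image_eq_zero_of_notMem_tsupport (hsupp t h0) : ρ (x - t) = 0)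
  have hηt : IsTestFunction Ω η := by
    refine ⟨hρs.comp (contDiff_const.sub contDiff_id), ?_, hηs.trans hLΩ⟩
    exact hL.of_isClosed_subset (isClosed_tsupport _) hηs
  have hgrad : ∀ t, gradient η t = - gradient ρ (x - t) := by
    intro t
    refine HasGradientAt.gradient ?_
    rw [hasGradientAt_iff_hasFDerivAt]
    have h1 : HasFDerivAt ρ (fderiv ℝ ρ (x - t)) (x - t) :=
      (hρs.differentiable (by simp)).differentiableAt.hasFDerivAt
    have h2 := h1.comp t ((hasFDerivAt_id t).const_sub x)
    refine h2.congr_fderiv ?_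
    ext v
    simp [gradient]
  have e := h.integral_eq η hηt
  have e1 : ∫ y in Ω, f y • gradient η y = - ∫ y, (L.indicator f y) • gradient ρ (x - y) := by
    rw [← integral_neg, setIntegral_eq_integral_of_forall_compl_eq_zero]
    · congr 1
      funext y
      by_cases hy : y ∈ L
      · simp [hy, hgrad]
      · have : gradient ρ (x - y) = 0 := by
          have h3 : x - y ∉ tsupport (fderiv ℝ ρ) := fun h4 =>
            hsupp y (fun h5 => hy (hx h5)) (tsupport_fderiv_subset ℝ h4)
          simp [gradient, image_eq_zero_of_notMem_tsupport h3]
        simp [hgrad, this]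
    · intro y hy
      have h3 : y ∉ tsupport (fderiv ℝ η) := fun h4 =>
        hy (hηt.tsupport_subset (tsupport_fderiv_subset ℝ h4))
      simp [gradient, image_eq_zero_of_notMem_tsupport h3]
  have e2 : ∫ y in Ω, η y • G y = ∫ y, ρ (x - y) • L.indicator G y := by
    rw [setIntegral_eq_integral_of_forall_compl_eq_zero]
    · congr 1
      funext y
      by_cases hy : y ∈ L
      · simp [hy, hη]
      · have : η y = 0 := image_eq_zero_of_notMem_tsupport fun h3 => hy (hηs h3)
        simp [this, hy]
    · intro y hy
      have : η y = 0 := image_eq_zero_of_notMem_tsupport fun h3 => hy (hLΩ (hηs h3))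
      simp [this]
  rw [e1, e2, neg_inj] at e
  have hfd := hρc.hasFDerivAt_convolution_left (ContinuousLinearMap.lsmul ℝ ℝ : ℝ →L[ℝ] ℝ →L[ℝ] ℝ)
    (hρs.of_le (by simp)) hf.locallyIntegrable x
  rw [hasGradientAt_iff_hasFDerivAt]
  refine hfd.congr_fderiv ?_
  rw [convolution_eq_swap, convolution_eq_swap]
  simp only [ContinuousLinearMap.lsmul_apply]
  rw [← e]
  have hgc : Continuous (gradient ρ) :=
    (InnerProductSpace.toDual ℝ _).symm.continuous.comp (hρs.continuous_fderiv (by simp))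
  have hfc : HasCompactSupport (fderiv ℝ ρ) := hρc.fderiv ℝ
  have hi1 : Integrable (fun t => (ContinuousLinearMap.precompL (EuclideanSpace ℝ (Fin n))
      (ContinuousLinearMap.lsmul ℝ ℝ : ℝ →L[ℝ] ℝ →L[ℝ] ℝ) (fderiv ℝ ρ (x - t)))
      (L.indicator f t)) := by
    have := (hfc.convolutionExists_left (ContinuousLinearMap.precompL (EuclideanSpace ℝ (Fin n))
      (ContinuousLinearMap.lsmul ℝ ℝ : ℝ →L[ℝ] ℝ →L[ℝ] ℝ)) (hρs.continuous_fderiv (by simp))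
      hf.locallyIntegrable) x
    exact this.integrable_swap
  have hbdd : ∃ C, ∀ y, ‖gradient ρ y‖ ≤ C := by
    obtain ⟨C, hC⟩ := hfc.exists_bound_of_continuous (hρs.continuous_fderiv (by simp))
    exact ⟨C, fun y => by simpa [gradient] using hC y⟩
  obtain ⟨C, hC⟩ := hbdd
  have hi2 : Integrable (fun t => L.indicator f t • gradient ρ (x - t)) := by
    refine hf.smul_bdd C
      (hgc.comp (continuous_const.sub continuous_id)).aestronglyMeasurable ?_
    exact Eventually.of_forall fun t => hC _
  ext v
  rw [ContinuousLinearMap.integral_apply hi1, InnerProductSpace.toDual_apply_apply,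
    real_inner_comm, ← integral_inner hi2]
  congr 1
  funext t
  rw [real_inner_comm, real_inner_smul_left, inner_gradient_left]
  simp [ContinuousLinearMap.precompL_apply, mul_comm]

/-! ### Integration by parts, L¹ limits and local smooth approximation -/

theorem continuous_gradient {n : ℕ} {u : EuclideanSpace ℝ (Fin n) → ℝ} (hu : ContDiff ℝ 1 u) :
    Continuous (gradient u) :=
  (InnerProductSpace.toDual ℝ _).symm.continuous.comp (hu.continuous_fderiv (by simp))

theorem gradient_eq_zero_of_notMem_tsupport {n : ℕ} {u : EuclideanSpace ℝ (Fin n) → ℝ}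
    {x : EuclideanSpace ℝ (Fin n)} (hx : x ∉ tsupport u) : gradient u x = 0 := by
  have h3 : x ∉ tsupport (fderiv ℝ u) := fun h4 => hx (tsupport_fderiv_subset ℝ h4)
  simp [gradient, image_eq_zero_of_notMem_tsupport h3]

theorem exists_norm_gradient_le {n : ℕ} {η : EuclideanSpace ℝ (Fin n) → ℝ}
    (hη : ContDiff ℝ 1 η) (hc : HasCompactSupport η) :
    ∃ C, ∀ x, ‖gradient η x‖ ≤ C := by
  obtain ⟨C, hC⟩ := (hc.fderiv ℝ).exists_bound_of_continuous (hη.continuous_fderiv (by simp))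
  exact ⟨C, fun y => by simpa [gradient] using hC y⟩

/-- Integration by parts against a test function. -/
theorem integral_smul_gradient_eq {n : ℕ} {u η : EuclideanSpace ℝ (Fin n) → ℝ}
    (hu : ContDiff ℝ 1 u) (hη : ContDiff ℝ 1 η) (hc : HasCompactSupport η) :
    ∫ x, u x • gradient η x = - ∫ x, η x • gradient u x := by
  have hgc : HasCompactSupport (gradient η) := by
    refine HasCompactSupport.intro' hc (isClosed_tsupport η) fun x hx => ?_
    exact gradient_eq_zero_of_notMem_tsupport hx
  have h1 : Integrable (fun x => u x • gradient η x) :=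
    (hu.continuous.smul (continuous_gradient hη)).integrable_of_hasCompactSupport hgc.smul_left
  have h2 : Integrable (fun x => η x • gradient u x) :=
    (hη.continuous.smul (continuous_gradient hu)).integrable_of_hasCompactSupport hc.smul_right
  have hfc : HasCompactSupport (fderiv ℝ η) := hc.fderiv ℝ
  refine ext_inner_left ℝ fun v => ?_
  rw [inner_neg_right, ← integral_inner h1, ← integral_inner h2]
  have e1 : ∀ x, inner ℝ v (u x • gradient η x) = u x * fderiv ℝ η x v := fun x => by
    rw [real_inner_comm, real_inner_smul_left, inner_gradient_left]
  have e2 : ∀ x, inner ℝ v (η x • gradient u x) = fderiv ℝ u x v * η x := fun x => by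
    rw [real_inner_comm, real_inner_smul_left, inner_gradient_left, mul_comm]
  simp_rw [e1, e2]
  refine integral_mul_fderiv_eq_neg_fderiv_mul_of_integrable ?_ ?_ ?_ ?_ ?_
  · simpa only [e2] using h2.const_inner (𝕜 := ℝ) v
  · simpa only [e1] using h1.const_inner (𝕜 := ℝ) v
  · exact (hu.continuous.mul hη.continuous).integrable_of_hasCompactSupport hc.mul_left
  · exact fun x _ => (hu.differentiable (by simp)).differentiableAt
  · exact fun x _ => (hη.differentiable (by simp)).differentiableAt

theorem setIntegral_smul_gradient_eq_of_tsupport_subset {n : ℕ}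
    {Ω : Set (EuclideanSpace ℝ (Fin n))} {η : EuclideanSpace ℝ (Fin n) → ℝ}
    (hη : tsupport η ⊆ Ω) (u : EuclideanSpace ℝ (Fin n) → ℝ) :
    ∫ x in Ω, u x • gradient η x = ∫ x, u x • gradient η x :=
  setIntegral_eq_integral_of_forall_compl_eq_zero fun x hx => by
    rw [gradient_eq_zero_of_notMem_tsupport fun h => hx (hη h), smul_zero]

theorem setIntegral_smul_eq_of_tsupport_subset {n : ℕ} {Ω : Set (EuclideanSpace ℝ (Fin n))}
    {η : EuclideanSpace ℝ (Fin n) → ℝ} (hη : tsupport η ⊆ Ω)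
    (G : EuclideanSpace ℝ (Fin n) → EuclideanSpace ℝ (Fin n)) :
    ∫ x in Ω, η x • G x = ∫ x, η x • G x :=
  setIntegral_eq_integral_of_forall_compl_eq_zero fun x hx => by
    rw [image_eq_zero_of_notMem_tsupport fun h => hx (hη h), zero_smul]

/-- For a `C¹` function the gradient is a weak gradient. -/
theorem hasWeakGradient_of_contDiff {n : ℕ} (Ω : Set (EuclideanSpace ℝ (Fin n)))
    {u : EuclideanSpace ℝ (Fin n) → ℝ} (hu : ContDiff ℝ 1 u) :
    HasWeakGradient Ω u (gradient u) where
  locallyIntegrableOn := hu.continuous.locallyIntegrable.locallyIntegrableOn Ω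
  locallyIntegrableOn_grad := (continuous_gradient hu).locallyIntegrable.locallyIntegrableOn Ω
  integral_eq η hη := by
    rw [setIntegral_smul_gradient_eq_of_tsupport_subset hη.tsupport_subset,
      setIntegral_smul_eq_of_tsupport_subset hη.tsupport_subset]
    exact integral_smul_gradient_eq hu (hη.contDiff.of_le (by simp)) hη.hasCompactSupport

/-- If `f` and `G` are limits, in `L¹` of the support of each test function, of functions that
satisfy the integration by parts formula, then `G` is a weak gradient of `f`. -/
theorem hasWeakGradient_of_tendsto {n : ℕ} {Ω : Set (EuclideanSpace ℝ (Fin n))}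
    {f : EuclideanSpace ℝ (Fin n) → ℝ} {G : EuclideanSpace ℝ (Fin n) → EuclideanSpace ℝ (Fin n)}
    (hf : LocallyIntegrableOn f Ω) (hG : LocallyIntegrableOn G Ω)
    (H : ∀ η, IsTestFunction Ω η → ∃ (u : ℕ → EuclideanSpace ℝ (Fin n) → ℝ)
      (g : ℕ → EuclideanSpace ℝ (Fin n) → EuclideanSpace ℝ (Fin n)),
      (∀ k, HasWeakGradient Ω (u k) (g k)) ∧
      Tendsto (fun k => ∫ x in tsupport η, ‖u k x - f x‖) atTop (𝓝 0) ∧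
      Tendsto (fun k => ∫ x in tsupport η, ‖g k x - G x‖) atTop (𝓝 0)) :
    HasWeakGradient Ω f G := by
  refine ⟨hf, hG, fun η hη => ?_⟩
  -- The approximating sequence may depend on `η`, so approximation near one compact set is enough
  -- and nothing is asked near the boundary of `Ω`.
  obtain ⟨u, g, hw, hu, hg⟩ := H η hη
  set K := tsupport η with hK
  have hKc : IsCompact K := hη.hasCompactSupport
  have hη1 : ContDiff ℝ 1 η := hη.contDiff.of_le (by simp)
  obtain ⟨C, hC⟩ := exists_norm_gradient_le hη1 hη.hasCompactSupport
  obtain ⟨D, hD⟩ := hη.hasCompactSupport.exists_bound_of_continuous hη.contDiff.continuous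
  have e1 : ∀ v : EuclideanSpace ℝ (Fin n) → ℝ,
      ∫ x in Ω, v x • gradient η x = ∫ x in K, v x • gradient η x := fun v => by
    rw [setIntegral_smul_gradient_eq_of_tsupport_subset hη.tsupport_subset,
      setIntegral_smul_gradient_eq_of_tsupport_subset subset_rfl]
  have e2 : ∀ v : EuclideanSpace ℝ (Fin n) → EuclideanSpace ℝ (Fin n),
      ∫ x in Ω, η x • v x = ∫ x in K, η x • v x := fun v => by
    rw [setIntegral_smul_eq_of_tsupport_subset hη.tsupport_subset,
      setIntegral_smul_eq_of_tsupport_subset subset_rfl]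
  have i1 : ∀ {v : EuclideanSpace ℝ (Fin n) → ℝ}, LocallyIntegrableOn v Ω →
      IntegrableOn (fun x => v x • gradient η x) K := fun hv =>
    (hv.integrableOn_compact_subset hη.tsupport_subset hKc).smul_continuousOn
      (continuous_gradient hη1).continuousOn hKc
  have i2 : ∀ {v : EuclideanSpace ℝ (Fin n) → EuclideanSpace ℝ (Fin n)},
      LocallyIntegrableOn v Ω → IntegrableOn (fun x => η x • v x) K := fun hv =>
    (hv.integrableOn_compact_subset hη.tsupport_subset hKc).continuousOn_smul
      hη1.continuous.continuousOn hKc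
  have t1 : Tendsto (fun k => ∫ x in K, u k x • gradient η x) atTop
      (𝓝 (∫ x in K, f x • gradient η x)) := by
    rw [tendsto_iff_norm_sub_tendsto_zero]
    refine squeeze_zero (fun _ => norm_nonneg _) (fun k => ?_) (by simpa using hu.mul_const C)
    rw [← integral_sub (i1 (hw k).locallyIntegrableOn) (i1 hf), ← integral_mul_const]
    refine norm_integral_le_of_norm_le ?_ (Eventually.of_forall fun x => ?_)
    · exact ((((hw k).locallyIntegrableOn.sub hf).integrableOn_compact_subset
        hη.tsupport_subset hKc).norm).mul_const C
    · rw [← sub_smul, norm_smul]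
      exact mul_le_mul_of_nonneg_left (hC x) (norm_nonneg _)
  have t2 : Tendsto (fun k => ∫ x in K, η x • g k x) atTop
      (𝓝 (∫ x in K, η x • G x)) := by
    rw [tendsto_iff_norm_sub_tendsto_zero]
    refine squeeze_zero (fun _ => norm_nonneg _) (fun k => ?_) (by simpa using hg.const_mul D)
    rw [← integral_sub (i2 (hw k).locallyIntegrableOn_grad) (i2 hG), ← integral_const_mul]
    refine norm_integral_le_of_norm_le ?_ (Eventually.of_forall fun x => ?_)
    · exact ((((hw k).locallyIntegrableOn_grad.sub hG).integrableOn_compact_subset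
        hη.tsupport_subset hKc).norm).const_mul D
    · rw [← smul_sub, norm_smul]
      gcongr
      exact hD x
  rw [e1, e2]
  refine tendsto_nhds_unique t1 (t2.neg.congr fun k => ?_)
  rw [← e1, ← e2, (hw k).integral_eq η hη]

/-- Local approximation of a weakly differentiable function by smooth functions. -/
theorem HasWeakGradient.exists_contDiff_tendsto {n : ℕ} {Ω : Set (EuclideanSpace ℝ (Fin n))}
    (hΩ : IsOpen Ω) {f : EuclideanSpace ℝ (Fin n) → ℝ}
    {G : EuclideanSpace ℝ (Fin n) → EuclideanSpace ℝ (Fin n)} (h : HasWeakGradient Ω f G)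
    {K : Set (EuclideanSpace ℝ (Fin n))} (hK : IsCompact K) (hKΩ : K ⊆ Ω) :
    ∃ u : ℕ → EuclideanSpace ℝ (Fin n) → ℝ, (∀ k, ContDiff ℝ 1 (u k)) ∧
      Tendsto (fun k => ∫ x in K, ‖u k x - f x‖) atTop (𝓝 0) ∧
      Tendsto (fun k => ∫ x in K, ‖gradient (u k) x - G x‖) atTop (𝓝 0) ∧
      ∀ᵐ x ∂volume.restrict K, Tendsto (fun k => u k x) atTop (𝓝 (f x)) := by
  -- The margin `δ` is the room for mollifying: as soon as the outer radius is at most `δ`, balls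
  -- around points of `K` stay inside `L`, where the cut-off functions agree with `f` and `G`. This
  -- is why the gradient estimate holds only for large `k`.
  obtain ⟨δ, hδ, hδΩ⟩ := hK.exists_cthickening_subset_open hΩ hKΩ
  set L := Metric.cthickening δ K with hL
  have hLc : IsCompact L := hK.cthickening
  have hKL : K ⊆ L := Metric.self_subset_cthickening K
  have hf : Integrable (L.indicator f) :=
    (h.locallyIntegrableOn.integrableOn_compact_subset hδΩ hLc).integrable_indicator
      hLc.measurableSet
  have hG : Integrable (L.indicator G) :=
    (h.locallyIntegrableOn_grad.integrableOn_compact_subset hδΩ hLc).integrable_indicator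
      hLc.measurableSet
  have hci : ∀ k, Integrable ((shrinkingBump n k).normed volume
      ⋆[ContinuousLinearMap.lsmul ℝ ℝ, volume] L.indicator f) := fun k =>
    ((shrinkingBump n k).integrable_normed (μ := volume)).integrable_convolution
      (ContinuousLinearMap.lsmul ℝ ℝ : ℝ →L[ℝ] ℝ →L[ℝ] ℝ) hf
  have hcG : ∀ k, Integrable ((shrinkingBump n k).normed volume
      ⋆[ContinuousLinearMap.lsmul ℝ ℝ, volume] L.indicator G) := fun k =>
    ((shrinkingBump n k).integrable_normed (μ := volume)).integrable_convolution
      (ContinuousLinearMap.lsmul ℝ ℝ :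
        ℝ →L[ℝ] EuclideanSpace ℝ (Fin n) →L[ℝ] EuclideanSpace ℝ (Fin n)) hG
  refine ⟨fun k => (shrinkingBump n k).normed volume
    ⋆[ContinuousLinearMap.lsmul ℝ ℝ, volume] L.indicator f, fun k => ?_, ?_, ?_, ?_⟩
  · exact ((shrinkingBump n k).hasCompactSupport_normed).contDiff_convolution_left _
      (shrinkingBump n k).contDiff_normed hf.locallyIntegrable (n := 1)
  · refine squeeze_zero (fun _ => integral_nonneg fun _ => norm_nonneg _) (fun k => ?_)
      (tendsto_integral_norm_convolution_sub hf)
    refine le_trans (le_of_eq ?_) (setIntegral_le_integral (s := K) ((hci k).sub hf).norm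
      (Eventually.of_forall fun _ => norm_nonneg _))
    refine setIntegral_congr_fun hK.measurableSet fun x hx => ?_
    simp [Set.indicator_of_mem (hKL hx)]
  · refine squeeze_zero' (Eventually.of_forall fun _ => integral_nonneg fun _ => norm_nonneg _) ?_
      (tendsto_integral_norm_convolution_sub hG)
    filter_upwards [(tendsto_shrinkingBump_rOut n).eventually (ge_mem_nhds hδ)] with k hk
    refine le_trans (le_of_eq ?_) (setIntegral_le_integral (s := K) ((hcG k).sub hG).norm
      (Eventually.of_forall fun _ => norm_nonneg _))
    refine setIntegral_congr_fun hK.measurableSet fun x hx => ?_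
    have hball : Metric.closedBall x (shrinkingBump n k).rOut ⊆ L :=
      (Metric.closedBall_subset_closedBall hk).trans
        (Metric.closedBall_subset_cthickening hx δ)
    have := (h.hasGradientAt_convolution hLc hδΩ (shrinkingBump n k) hball).gradient
    simp [Set.indicator_of_mem (hKL hx), this]
  · have := ContDiffBump.ae_convolution_tendsto_right_of_locallyIntegrable (K := 2)
      (tendsto_shrinkingBump_rOut n) (Eventually.of_forall fun k => by
        simp [shrinkingBump, div_eq_mul_inv]) hf.locallyIntegrable
    rw [ae_restrict_iff' hK.measurableSet]
    filter_upwards [this] with x hx hxK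
    simpa [Set.indicator_of_mem (hKL hxK)] using hx

/-! ### Chain rule and truncation -/

/-- Chain rule for weak gradients. -/
theorem HasWeakGradient.comp_contDiff {n : ℕ} {Ω : Set (EuclideanSpace ℝ (Fin n))}
    (hΩ : IsOpen Ω) {f : EuclideanSpace ℝ (Fin n) → ℝ}
    {G : EuclideanSpace ℝ (Fin n) → EuclideanSpace ℝ (Fin n)} (h : HasWeakGradient Ω f G)
    {Φ : ℝ → ℝ} (hΦ : ContDiff ℝ 1 Φ) (hΦ' : ∀ t, ‖deriv Φ t‖ ≤ 1) :
    HasWeakGradient Ω (fun x => Φ (f x)) (fun x => deriv Φ (f x) • G x) := by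
  have hlip : ∀ s t, ‖Φ s - Φ t‖ ≤ ‖s - t‖ := fun s t => by
    simpa using convex_univ.norm_image_sub_le_of_norm_deriv_le
      (fun x _ => (hΦ.differentiable (by simp)).differentiableAt) (fun x _ => hΦ' x)
      (Set.mem_univ t) (Set.mem_univ s)
  have hdc : Continuous (deriv Φ) := hΦ.continuous_deriv (by simp)
  have hLC : IsLocallyClosed Ω := hΩ.isLocallyClosed
  have hf := (locallyIntegrableOn_iff hLC).1 h.locallyIntegrableOn
  have hG := (locallyIntegrableOn_iff hLC).1 h.locallyIntegrableOn_grad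
  refine hasWeakGradient_of_tendsto ((locallyIntegrableOn_iff hLC).2 fun K hKΩ hK => ?_)
    ((locallyIntegrableOn_iff hLC).2 fun K hKΩ hK => ?_) fun η hη => ?_
  · have hc : IntegrableOn (fun _ : EuclideanSpace ℝ (Fin n) => ‖Φ 0‖) K :=
      integrableOn_const hK.measure_lt_top.ne
    refine Integrable.mono' (hc.add (hf K hKΩ hK).norm)
      (hΦ.continuous.comp_aestronglyMeasurable (hf K hKΩ hK).aestronglyMeasurable)
      (Eventually.of_forall fun x => ?_)
    have h1 := hlip (f x) 0
    have h2 := norm_sub_norm_le (Φ (f x)) (Φ 0)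
    simp only [sub_zero] at h1
    simp only [Pi.add_apply]
    linarith
  · refine Integrable.mono' (hG K hKΩ hK).norm
      ((hdc.comp_aestronglyMeasurable (hf K hKΩ hK).aestronglyMeasurable).smul
        (hG K hKΩ hK).aestronglyMeasurable) (Eventually.of_forall fun x => ?_)
    rw [norm_smul]
    exact mul_le_of_le_one_left (norm_nonneg _) (hΦ' _)
  · have hK : IsCompact (tsupport η) := hη.hasCompactSupport
    obtain ⟨u, hu, h1, h2, h3⟩ := h.exists_contDiff_tendsto hΩ hK hη.tsupport_subset
    have hfK := hf _ hη.tsupport_subset hK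
    have hGK := hG _ hη.tsupport_subset hK
    have huK : ∀ k, IntegrableOn (fun x => u k x - f x) (tsupport η) := fun k =>
      ((hu k).continuous.continuousOn.integrableOn_compact hK).sub hfK
    have hgK : ∀ k, IntegrableOn (fun x => gradient (u k) x - G x) (tsupport η) := fun k =>
      ((continuous_gradient (hu k)).continuousOn.integrableOn_compact hK).sub hGK
    refine ⟨fun k x => Φ (u k x), fun k => gradient fun x => Φ (u k x),
      fun k => hasWeakGradient_of_contDiff Ω (hΦ.comp (hu k)), ?_, ?_⟩
    · refine squeeze_zero (fun _ => integral_nonneg fun _ => norm_nonneg _) (fun k => ?_) h1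
      refine integral_mono_of_nonneg (Eventually.of_forall fun _ => norm_nonneg _) (huK k).norm
        (Eventually.of_forall fun x => hlip _ _)
    · have hgrad : ∀ k x, gradient (fun x => Φ (u k x)) x = deriv Φ (u k x) • gradient (u k) x := by
        intro k x
        have e : HasFDerivAt (u k) (fderiv ℝ (u k) x) x :=
          ((hu k).differentiable (by simp)).differentiableAt.hasFDerivAt
        have e' : HasDerivAt Φ (deriv Φ (u k x)) (u k x) :=
          (hΦ.differentiable (by simp)).differentiableAt.hasDerivAt
        have := (e'.comp_hasFDerivAt x e).fderiv
        simp only [gradient]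
        rw [show (fun x => Φ (u k x)) = Φ ∘ u k from rfl, this, map_smul]
      have hi : ∀ k, IntegrableOn (fun x => (deriv Φ (u k x) - deriv Φ (f x)) • G x)
          (tsupport η) := fun k => by
        refine Integrable.mono' (hGK.norm.const_mul 2)
          (((hdc.comp (hu k).continuous).aestronglyMeasurable.sub
            (hdc.comp_aestronglyMeasurable hfK.aestronglyMeasurable)).smul
            hGK.aestronglyMeasurable) (Eventually.of_forall fun x => ?_)
        rw [norm_smul]
        gcongr
        have := norm_sub_le (deriv Φ (u k x)) (deriv Φ (f x))
        linarith [hΦ' (u k x), hΦ' (f x)]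
      -- The error Φ'(u_k)∇u_k - Φ'(f)G splits as Φ'(u_k)(∇u_k - G) + (Φ'(u_k) - Φ'(f))G. The first
      -- term is controlled by `h2`; the second is dominated by 2‖G‖ and tends to 0 wherever u_k →
      -- f.
      have h4 : Tendsto (fun k => ∫ x in tsupport η, ‖(deriv Φ (u k x) - deriv Φ (f x)) • G x‖)
          atTop (𝓝 (∫ x in tsupport η, (0 : ℝ))) := by
        refine tendsto_integral_of_dominated_convergence (fun x => 2 * ‖G x‖)
          (fun k => (hi k).norm.aestronglyMeasurable) (hGK.norm.const_mul 2) (fun k => ?_) ?_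
        · refine Eventually.of_forall fun x => ?_
          rw [norm_norm, norm_smul]
          gcongr
          have := norm_sub_le (deriv Φ (u k x)) (deriv Φ (f x))
          linarith [hΦ' (u k x), hΦ' (f x)]
        · filter_upwards [h3] with x hx
          have := (((hdc.tendsto (f x)).comp hx).sub_const (deriv Φ (f x))).smul_const (G x)
          simpa using this.norm
      rw [integral_zero] at h4
      refine squeeze_zero (fun _ => integral_nonneg fun _ => norm_nonneg _) (fun k => ?_)
        (by simpa using h2.add h4)
      rw [← integral_add (hgK k).norm (hi k).norm]
      refine integral_mono_of_nonneg (Eventually.of_forall fun _ => norm_nonneg _)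
        ((hgK k).norm.add (hi k).norm) (Eventually.of_forall fun x => ?_)
      simp only [hgrad]
      have : deriv Φ (u k x) • gradient (u k) x - deriv Φ (f x) • G x
          = deriv Φ (u k x) • (gradient (u k) x - G x)
            + (deriv Φ (u k x) - deriv Φ (f x)) • G x := by
        rw [smul_sub, sub_smul]
        abel
      rw [this]
      refine (norm_add_le _ _).trans ?_
      gcongr
      rw [norm_smul]
      exact mul_le_of_le_one_left (norm_nonneg _) (hΦ' _)

/-- A smooth approximation of the positive part. -/
noncomputable def smoothPosPart (ε t : ℝ) : ℝ := (Real.sqrt (t ^ 2 + ε ^ 2) + t) / 2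

theorem hasDerivAt_smoothPosPart {ε : ℝ} (hε : 0 < ε) (t : ℝ) :
    HasDerivAt (smoothPosPart ε) ((t / Real.sqrt (t ^ 2 + ε ^ 2) + 1) / 2) t := by
  have hpos : 0 < t ^ 2 + ε ^ 2 := by positivity
  have h1 : HasDerivAt (fun t : ℝ => t ^ 2 + ε ^ 2) (2 * t) t := by
    simpa using (hasDerivAt_pow 2 t).add_const (ε ^ 2)
  have h2 := ((h1.sqrt hpos.ne').add (hasDerivAt_id t)).div_const 2
  refine h2.congr_deriv ?_
  have : Real.sqrt (t ^ 2 + ε ^ 2) ≠ 0 := (Real.sqrt_pos.2 hpos).ne'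
  field_simp

theorem contDiff_smoothPosPart {ε : ℝ} (hε : 0 < ε) : ContDiff ℝ 1 (smoothPosPart ε) := by
  have h1 : ContDiff ℝ 1 (fun t : ℝ => t ^ 2 + ε ^ 2) := by fun_prop
  exact ((h1.sqrt fun t => by positivity).add contDiff_id).div_const 2

theorem abs_div_sqrt_le_one (ε t : ℝ) : |t / Real.sqrt (t ^ 2 + ε ^ 2)| ≤ 1 := by
  rw [abs_div, abs_of_nonneg (Real.sqrt_nonneg _)]
  refine div_le_one_of_le₀ ?_ (Real.sqrt_nonneg _)
  exact Real.abs_le_sqrt (by nlinarith)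

theorem norm_deriv_smoothPosPart_le {ε : ℝ} (hε : 0 < ε) (t : ℝ) :
    ‖deriv (smoothPosPart ε) t‖ ≤ 1 := by
  rw [(hasDerivAt_smoothPosPart hε t).deriv, Real.norm_eq_abs, abs_le]
  have := abs_le.1 (abs_div_sqrt_le_one ε t)
  constructor <;> linarith [this.1, this.2]

theorem abs_smoothPosPart_sub_le {ε : ℝ} (hε : 0 < ε) (t : ℝ) :
    |smoothPosPart ε t - max t 0| ≤ ε := by
  have h1 : |t| ≤ Real.sqrt (t ^ 2 + ε ^ 2) := Real.abs_le_sqrt (by nlinarith)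
  have h2 : Real.sqrt (t ^ 2 + ε ^ 2) ≤ |t| + ε := by
    rw [Real.sqrt_le_left (by positivity)]
    nlinarith [sq_abs t, abs_nonneg t]
  have h3 : max t 0 = (|t| + t) / 2 := by
    rcases le_total t 0 with h | h
    · rw [max_eq_right h, abs_of_nonpos h]; ring
    · rw [max_eq_left h, abs_of_nonneg h]; ring
  rw [h3, smoothPosPart, abs_le]
  constructor <;> linarith

/-- The pointwise limit of the derivatives of `smoothPosPart ε` as `ε → 0`. -/
noncomputable def posPartSlope (t : ℝ) : ℝ := (SignType.sign t + 1) / 2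

theorem tendsto_deriv_smoothPosPart {ε : ℕ → ℝ} (hε : ∀ k, 0 < ε k)
    (h0 : Tendsto ε atTop (𝓝 0)) (t : ℝ) :
    Tendsto (fun k => deriv (smoothPosPart (ε k)) t) atTop (𝓝 (posPartSlope t)) := by
  have e : ∀ k, deriv (smoothPosPart (ε k)) t = (t / Real.sqrt (t ^ 2 + ε k ^ 2) + 1) / 2 :=
    fun k => (hasDerivAt_smoothPosPart (hε k) t).deriv
  simp_rw [e, posPartSlope]
  refine Tendsto.div_const (Tendsto.add_const 1 ?_) 2
  rcases eq_or_ne t 0 with rfl | ht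
  -- At 0 every approximation has slope 1/2, which is the value of `posPartSlope` there. With this
  -- convention it need not be known that the weak gradient vanishes almost everywhere on the zero
  -- set.
  · simp
  · have h1 : Tendsto (fun k => Real.sqrt (t ^ 2 + ε k ^ 2)) atTop (𝓝 |t|) := by
      have := ((h0.pow 2).const_add (t ^ 2)).sqrt
      simpa [Real.sqrt_sq_eq_abs] using this
    have h2 := (tendsto_const_nhds (x := t)).div h1 (abs_pos.2 ht).ne'
    have h3 : (SignType.sign t : ℝ) = t / |t| := by
      rcases lt_or_gt_of_ne ht with h | h
      · rw [sign_neg h, abs_of_neg h, div_neg, div_self ht]; simp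
      · rw [sign_pos h, abs_of_pos h, div_self ht]; simp
    rw [h3]
    exact h2

/-- Truncation: the positive part of a weakly differentiable function is weakly differentiable. -/
theorem HasWeakGradient.posPart {n : ℕ} {Ω : Set (EuclideanSpace ℝ (Fin n))}
    (hΩ : IsOpen Ω) {f : EuclideanSpace ℝ (Fin n) → ℝ}
    {G : EuclideanSpace ℝ (Fin n) → EuclideanSpace ℝ (Fin n)} (h : HasWeakGradient Ω f G) :
    HasWeakGradient Ω (fun x => max (f x) 0) (fun x => posPartSlope (f x) • G x) := by
  set ε : ℕ → ℝ := fun k => 1 / ((k : ℝ) + 1) with hε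
  have hε0 : ∀ k, 0 < ε k := fun k => by positivity
  have hεt : Tendsto ε atTop (𝓝 0) := tendsto_one_div_add_atTop_nhds_zero_nat
  have hw := fun k => h.comp_contDiff hΩ (contDiff_smoothPosPart (hε0 k))
    (norm_deriv_smoothPosPart_le (hε0 k))
  have hslope : ∀ t, ‖posPartSlope t‖ ≤ 1 := fun t =>
    le_of_tendsto (tendsto_deriv_smoothPosPart hε0 hεt t).norm
      (Eventually.of_forall fun k => norm_deriv_smoothPosPart_le (hε0 k) t)
  have hLC : IsLocallyClosed Ω := hΩ.isLocallyClosed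
  have hf := (locallyIntegrableOn_iff hLC).1 h.locallyIntegrableOn
  have hG := (locallyIntegrableOn_iff hLC).1 h.locallyIntegrableOn_grad
  have hposK : ∀ K, K ⊆ Ω → IsCompact K → IntegrableOn (fun x => max (f x) 0) K :=
    fun K hKΩ hK => (hf K hKΩ hK).pos_part
  have hslK : ∀ K, K ⊆ Ω → IsCompact K → IntegrableOn (fun x => posPartSlope (f x) • G x) K := by
    intro K hKΩ hK
    refine Integrable.mono' (hG K hKΩ hK).norm ?_ (Eventually.of_forall fun x => ?_)
    · refine aestronglyMeasurable_of_tendsto_ae atTop (fun k =>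
        ((hw k).locallyIntegrableOn_grad.integrableOn_compact_subset hKΩ hK).aestronglyMeasurable)
        (Eventually.of_forall fun x => ?_)
      exact (tendsto_deriv_smoothPosPart hε0 hεt (f x)).smul_const (G x)
    · rw [norm_smul]
      exact mul_le_of_le_one_left (norm_nonneg _) (hslope _)
  refine hasWeakGradient_of_tendsto ((locallyIntegrableOn_iff hLC).2 hposK)
    ((locallyIntegrableOn_iff hLC).2 hslK) fun η hη => ⟨_, _, hw, ?_, ?_⟩
  · have hK : IsCompact (tsupport η) := hη.hasCompactSupport
    refine squeeze_zero (fun _ => integral_nonneg fun _ => norm_nonneg _) (fun k => ?_)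
      (by simpa using hεt.const_mul (volume.real (tsupport η)))
    have hc : IntegrableOn (fun _ : EuclideanSpace ℝ (Fin n) => ε k) (tsupport η) :=
      integrableOn_const hK.measure_lt_top.ne
    refine (integral_mono_of_nonneg (Eventually.of_forall fun _ => norm_nonneg _) hc
      (Eventually.of_forall fun x => abs_smoothPosPart_sub_le (hε0 k) (f x))).trans ?_
    simp
  · have hK : IsCompact (tsupport η) := hη.hasCompactSupport
    have hGK := hG _ hη.tsupport_subset hK
    have h4 : Tendsto (fun k => ∫ x in tsupport η,
        ‖deriv (smoothPosPart (ε k)) (f x) • G x - posPartSlope (f x) • G x‖)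
        atTop (𝓝 (∫ x in tsupport η, (0 : ℝ))) := by
      refine tendsto_integral_of_dominated_convergence (fun x => 2 * ‖G x‖)
        (fun k => ?_) (hGK.norm.const_mul 2) (fun k => ?_) ?_
      · exact (((hw k).locallyIntegrableOn_grad.integrableOn_compact_subset
          hη.tsupport_subset hK).sub (hslK _ hη.tsupport_subset hK)).norm.aestronglyMeasurable
      · refine Eventually.of_forall fun x => ?_
        rw [norm_norm, ← sub_smul, norm_smul]
        gcongr
        have := norm_sub_le (deriv (smoothPosPart (ε k)) (f x)) (posPartSlope (f x))
        linarith [norm_deriv_smoothPosPart_le (hε0 k) (f x), hslope (f x)]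
      · refine Eventually.of_forall fun x => ?_
        have := ((tendsto_deriv_smoothPosPart hε0 hεt (f x)).smul_const (G x)).sub_const
          (posPartSlope (f x) • G x)
        simpa using this.norm
    rwa [integral_zero] at h4

/-! ### Uniform convexity of powers of a norm -/

section UniformConvexity

variable {F : Type*} [NormedAddCommGroup F] [NormedSpace ℝ F]

/-- The defect in the midpoint convexity inequality for `‖·‖ ^ p`. -/
noncomputable def midpointDefect (p : ℝ) (a b : F) : ℝ :=
  (‖a‖ ^ p + ‖b‖ ^ p) / 2 - ‖(1 / 2 : ℝ) • (a + b)‖ ^ p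

theorem norm_half_smul_add_le (a b : F) : ‖(1 / 2 : ℝ) • (a + b)‖ ≤ (‖a‖ + ‖b‖) / 2 := by
  rw [norm_smul]
  have := norm_add_le a b
  norm_num
  linarith

theorem half_add_rpow_le {p s t : ℝ} (hp : 1 ≤ p) (hs : 0 ≤ s) (ht : 0 ≤ t) :
    ((s + t) / 2) ^ p ≤ (s ^ p + t ^ p) / 2 := by
  have := (convexOn_rpow hp).2 (Set.mem_Ici.2 hs) (Set.mem_Ici.2 ht)
    (by norm_num : (0 : ℝ) ≤ 1 / 2) (by norm_num : (0 : ℝ) ≤ 1 / 2) (by norm_num)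
  simp only [smul_eq_mul] at this
  calc ((s + t) / 2) ^ p = (1 / 2 * s + 1 / 2 * t) ^ p := by ring_nf
    _ ≤ _ := this
    _ = _ := by ring

theorem midpointDefect_nonneg {p : ℝ} (hp : 1 ≤ p) (a b : F) : 0 ≤ midpointDefect p a b := by
  have h1 : ‖(1 / 2 : ℝ) • (a + b)‖ ^ p ≤ ((‖a‖ + ‖b‖) / 2) ^ p :=
    Real.rpow_le_rpow (norm_nonneg _) (norm_half_smul_add_le a b) (by linarith)
  have h2 := half_add_rpow_le hp (norm_nonneg a) (norm_nonneg b)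
  unfold midpointDefect
  linarith

/-- Vectors of equal norm are separated by strict convexity of the ball, vectors of different norms
by strict convexity of t ↦ t^p. -/
theorem midpointDefect_pos [StrictConvexSpace ℝ F] {p : ℝ} (hp : 1 < p) {a b : F} (hab : a ≠ b) :
    0 < midpointDefect p a b := by
  unfold midpointDefect
  rw [sub_pos]
  by_cases h : ‖a‖ = ‖b‖
  · have h1 : ‖(1 / 2 : ℝ) • (a + b)‖ < ‖a‖ := by
      rw [smul_add]
      exact norm_combo_lt_of_ne le_rfl h.symm.le hab (by norm_num) (by norm_num) (by norm_num)
    have := Real.rpow_lt_rpow (norm_nonneg _) h1 (by linarith : 0 < p)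
    rw [← h]
    linarith
  · have h1 := (strictConvexOn_rpow hp).2 (Set.mem_Ici.2 (norm_nonneg a))
      (Set.mem_Ici.2 (norm_nonneg b)) h (by norm_num : (0 : ℝ) < 1 / 2)
      (by norm_num : (0 : ℝ) < 1 / 2) (by norm_num)
    simp only [smul_eq_mul] at h1
    have h2 : ‖(1 / 2 : ℝ) • (a + b)‖ ^ p ≤ (1 / 2 * ‖a‖ + 1 / 2 * ‖b‖) ^ p :=
      Real.rpow_le_rpow (norm_nonneg _)
        ((norm_half_smul_add_le a b).trans (by linarith)) (by linarith)
    linarith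

/-- Homogeneity reduces the uniform convexity estimate to the unit sphere of the product, which is
compact in finite dimension. -/
theorem midpointDefect_smul {p : ℝ} {r : ℝ} (hr : 0 ≤ r) (a b : F) :
    midpointDefect p (r • a) (r • b) = r ^ p * midpointDefect p a b := by
  unfold midpointDefect
  rw [← smul_add, smul_comm, norm_smul r a, norm_smul r b, norm_smul r ((1 / 2 : ℝ) • (a + b)),
    Real.norm_of_nonneg hr, Real.mul_rpow hr (norm_nonneg _), Real.mul_rpow hr (norm_nonneg _),
    Real.mul_rpow hr (norm_nonneg _)]
  ring

theorem continuous_midpointDefect {p : ℝ} (hp : 0 ≤ p) :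
    Continuous fun z : F × F => midpointDefect p z.1 z.2 := by
  unfold midpointDefect
  have h : ∀ {f : F × F → F}, Continuous f → Continuous fun z => ‖f z‖ ^ p := fun hf =>
    hf.norm.rpow_const fun _ => Or.inr hp
  exact (((h continuous_fst).add (h continuous_snd)).div_const 2).sub
    (h ((continuous_fst.add continuous_snd).const_smul _))

/-- Uniform convexity of `‖·‖ ^ p` on a finite-dimensional strictly convex space. -/
theorem exists_norm_sub_rpow_le [StrictConvexSpace ℝ F] [FiniteDimensional ℝ F] {p : ℝ}
    (hp : 1 < p) {ε : ℝ} (hε : 0 < ε) :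
    ∃ C, 0 ≤ C ∧ ∀ a b : F,
      ‖a - b‖ ^ p ≤ ε * (‖a‖ ^ p + ‖b‖ ^ p) + C * midpointDefect p a b := by
  have hp0 : 0 ≤ p := by linarith
  have hcont : ∀ {f : F × F → F}, Continuous f → Continuous fun z => ‖f z‖ ^ p := fun hf =>
    hf.norm.rpow_const fun _ => Or.inr hp0
  have := FiniteDimensional.proper ℝ (F × F)
  -- Only pairs for which the ε-term does not already suffice need the constant `C`. On this compact
  -- set a ≠ b, so the defect is positive, and `C` can be taken as the maximum of ‖a - b‖^p divided
  -- by the defect.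
  set S : Set (F × F) := Metric.sphere 0 1 ∩
    {z | ε * (‖z.1‖ ^ p + ‖z.2‖ ^ p) ≤ ‖z.1 - z.2‖ ^ p} with hS
  have hSc : IsCompact S := (isCompact_sphere _ _).inter_right
    (isClosed_le (((hcont continuous_fst).add (hcont continuous_snd)).const_mul ε)
      (hcont (continuous_fst.sub continuous_snd)))
  have hpos : ∀ z ∈ S, 0 < midpointDefect p z.1 z.2 := by
    rintro ⟨a, b⟩ ⟨h1, h2⟩
    refine midpointDefect_pos hp fun hab => ?_
    simp only at hab
    subst hab
    simp only [Set.mem_ofPred_eq, sub_self, norm_zero, Real.zero_rpow (by linarith : p ≠ 0)] at h2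
    have ha : ‖a‖ = 1 := by simpa [Prod.norm_def] using h1
    rw [ha, Real.one_rpow] at h2
    linarith
  have hC : ∃ C, 0 ≤ C ∧ ∀ z ∈ S, ‖z.1 - z.2‖ ^ p ≤ C * midpointDefect p z.1 z.2 := by
    rcases S.eq_empty_or_nonempty with h | h
    · exact ⟨0, le_rfl, by simp [h]⟩
    · have hc : ContinuousOn
          (fun z : F × F => ‖z.1 - z.2‖ ^ p / midpointDefect p z.1 z.2) S :=
        (hcont (continuous_fst.sub continuous_snd)).continuousOn.div
          (continuous_midpointDefect hp0).continuousOn fun z hz => (hpos z hz).ne'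
      obtain ⟨z, hz, hmax⟩ := hSc.exists_isMaxOn h hc
      refine ⟨‖z.1 - z.2‖ ^ p / midpointDefect p z.1 z.2,
        div_nonneg (by positivity) (hpos z hz).le, fun w hw => ?_⟩
      rw [← div_le_iff₀ (hpos w hw)]
      exact hmax hw
  obtain ⟨C, hC0, hC⟩ := hC
  refine ⟨C, hC0, fun a b => ?_⟩
  by_cases hab : ((a, b) : F × F) = 0
  · simp only [Prod.mk_eq_zero] at hab
    rw [hab.1, hab.2]
    have := midpointDefect_nonneg hp.le (0 : F) 0
    simp only [sub_self, norm_zero, Real.zero_rpow (by linarith : p ≠ 0)]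
    simpa using mul_nonneg hC0 this
  · set r := ‖((a, b) : F × F)‖ with hr
    have hr0 : 0 < r := norm_pos_iff.2 hab
    set a' := r⁻¹ • a
    set b' := r⁻¹ • b
    have ea : a = r • a' := by simp [a', smul_smul, hr0.ne']
    have eb : b = r • b' := by simp [b', smul_smul, hr0.ne']
    have hsph : ((a', b') : F × F) ∈ Metric.sphere (0 : F × F) 1 := by
      rw [mem_sphere_zero_iff_norm, show ((a', b') : F × F) = r⁻¹ • (a, b) from rfl, norm_smul,
        norm_inv, Real.norm_of_nonneg hr0.le, ← hr, inv_mul_cancel₀ hr0.ne']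
    have key : ‖a' - b'‖ ^ p ≤ ε * (‖a'‖ ^ p + ‖b'‖ ^ p) + C * midpointDefect p a' b' := by
      have hd := mul_nonneg hC0 (midpointDefect_nonneg hp.le a' b')
      by_cases h : ε * (‖a'‖ ^ p + ‖b'‖ ^ p) ≤ ‖a' - b'‖ ^ p
      · have h1 := hC (a', b') ⟨hsph, h⟩
        have : 0 ≤ ε * (‖a'‖ ^ p + ‖b'‖ ^ p) := by positivity
        simp only at h1
        linarith
      · linarith [not_le.1 h]
    rw [ea, eb, midpointDefect_smul hr0.le, ← smul_sub, norm_smul r (a' - b'), norm_smul r a',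
      norm_smul r b', Real.norm_of_nonneg hr0.le, Real.mul_rpow hr0.le (norm_nonneg _),
      Real.mul_rpow hr0.le (norm_nonneg _), Real.mul_rpow hr0.le (norm_nonneg _)]
    have := mul_le_mul_of_nonneg_left key (Real.rpow_nonneg hr0.le p)
    linarith

end UniformConvexity

/-! ### From vanishing midpoint defects to strong convergence -/

theorem integrable_norm_rpow_of_memLp {α F : Type*} [MeasurableSpace α] {μ : Measure α}
    [NormedAddCommGroup F] {p : ℝ} (hp : 1 < p) {f : α → F} (hf : MemLp f (ENNReal.ofReal p) μ) :
    Integrable (fun x => ‖f x‖ ^ p) μ := by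
  have := hf.integrable_norm_rpow (by simpa using by linarith) ENNReal.ofReal_ne_top
  rwa [ENNReal.toReal_ofReal (by linarith)] at this

theorem eLpNorm_eq_ofReal_integral {α F : Type*} [MeasurableSpace α] {μ : Measure α}
    [NormedAddCommGroup F] {p : ℝ} (hp : 1 < p) {f : α → F} (hf : MemLp f (ENNReal.ofReal p) μ) :
    eLpNorm f (ENNReal.ofReal p) μ = ENNReal.ofReal ((∫ x, ‖f x‖ ^ p ∂μ) ^ p⁻¹) := by
  rw [hf.eLpNorm_eq_integral_rpow_norm (by simpa using by linarith) ENNReal.ofReal_ne_top,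
    ENNReal.toReal_ofReal (by linarith)]

theorem integrable_midpointDefect {α F : Type*} [MeasurableSpace α] {μ : Measure α}
    [NormedAddCommGroup F] [NormedSpace ℝ F] {p : ℝ} (hp : 1 < p) {f g : α → F}
    (hf : MemLp f (ENNReal.ofReal p) μ) (hg : MemLp g (ENNReal.ofReal p) μ) :
    Integrable (fun x => midpointDefect p (f x) (g x)) μ :=
  (((integrable_norm_rpow_of_memLp hp hf).add (integrable_norm_rpow_of_memLp hp hg)).div_const
    2).sub (integrable_norm_rpow_of_memLp hp ((hf.add hg).const_smul (1 / 2 : ℝ)))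

theorem integral_midpointDefect {α F : Type*} [MeasurableSpace α] {μ : Measure α}
    [NormedAddCommGroup F] [NormedSpace ℝ F] {p : ℝ} (hp : 1 < p) {f g : α → F}
    (hf : MemLp f (ENNReal.ofReal p) μ) (hg : MemLp g (ENNReal.ofReal p) μ) :
    ∫ x, midpointDefect p (f x) (g x) ∂μ =
      ((∫ x, ‖f x‖ ^ p ∂μ) + ∫ x, ‖g x‖ ^ p ∂μ) / 2
        - ∫ x, ‖((1 / 2 : ℝ) • (f + g)) x‖ ^ p ∂μ := by
  have h1 := integrable_norm_rpow_of_memLp hp hf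
  have h2 := integrable_norm_rpow_of_memLp hp hg
  have h3 := integrable_norm_rpow_of_memLp hp ((hf.add hg).const_smul (1 / 2 : ℝ))
  have h4 : Integrable (fun x => (‖f x‖ ^ p + ‖g x‖ ^ p) / 2) μ := (h1.add h2).div_const 2
  unfold midpointDefect
  rw [← integral_add h1 h2, ← integral_div]
  exact integral_sub h4 h3

/-- A sequence that is Cauchy in `L^p` converges in `L^p`. -/
theorem exists_memLp_tendsto_of_cauchy {α F : Type*} [MeasurableSpace α] {μ : Measure α}
    [NormedAddCommGroup F] [CompleteSpace F] {p : ℝ≥0∞} (hp : 1 ≤ p) {f : ℕ → α → F}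
    (hf : ∀ k, MemLp (f k) p μ)
    (hc : ∀ ε > 0, ∃ N, ∀ k ≥ N, ∀ l ≥ N, eLpNorm (f k - f l) p μ < ENNReal.ofReal ε) :
    ∃ g, MemLp g p μ ∧ Tendsto (fun k => eLpNorm (f k - g) p μ) atTop (𝓝 0) := by
  have : Fact (1 ≤ p) := ⟨hp⟩
  have hcs : CauchySeq fun k => (hf k).toLp (f k) := by
    rw [Metric.cauchySeq_iff]
    intro ε hε
    obtain ⟨N, hN⟩ := hc ε hε
    refine ⟨N, fun k hk l hl => ?_⟩
    rw [dist_edist, Lp.edist_toLp_toLp]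
    exact ENNReal.toReal_lt_of_lt_ofReal (hN k hk l hl)
  obtain ⟨g, hg⟩ := cauchySeq_tendsto_of_complete hcs
  refine ⟨g, Lp.memLp g, ?_⟩
  rw [← Lp.toLp_coeFn g (Lp.memLp g)] at hg
  exact (Lp.tendsto_Lp_iff_tendsto_eLpNorm'' f hf g (Lp.memLp g)).1 hg

/-- Bounded sequences with vanishing midpoint defects converge in `L^p`. -/
theorem exists_memLp_tendsto_of_midpointDefect {α F : Type*} [MeasurableSpace α] {μ : Measure α}
    [NormedAddCommGroup F] [NormedSpace ℝ F] [StrictConvexSpace ℝ F] [FiniteDimensional ℝ F]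
    {p : ℝ} (hp : 1 < p) {f : ℕ → α → F} (hf : ∀ k, MemLp (f k) (ENNReal.ofReal p) μ) {B : ℝ}
    (hB : ∀ k, ∫ x, ‖f k x‖ ^ p ∂μ ≤ B)
    (hd : ∀ ε > 0, ∃ N, ∀ k ≥ N, ∀ l ≥ N, ∫ x, midpointDefect p (f k x) (f l x) ∂μ < ε) :
    ∃ g, MemLp g (ENNReal.ofReal p) μ ∧
      Tendsto (fun k => eLpNorm (f k - g) (ENNReal.ofReal p) μ) atTop (𝓝 0) := by
  have := FiniteDimensional.complete ℝ F
  have hB0 : 0 ≤ B := (integral_nonneg fun x => by positivity).trans (hB 0)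
  refine exists_memLp_tendsto_of_cauchy (by simpa using hp.le) hf fun ε hε => ?_
  set τ := ε ^ p with hτ
  have hτ0 : 0 < τ := Real.rpow_pos_of_pos hε p
  -- Since both p-th power integrals are at most `B`, the first term will contribute at most τ/2,
  -- and the defect term at most τ/4. The `+ 1` in the denominators guards against B = 0 and C = 0.
  obtain ⟨C, hC0, hC⟩ := exists_norm_sub_rpow_le (F := F) hp
    (ε := τ / (4 * (B + 1))) (by positivity)
  obtain ⟨N, hN⟩ := hd (τ / (4 * (C + 1))) (by positivity)
  refine ⟨N, fun k hk l hl => ?_⟩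
  have hkl := (hf k).sub (hf l)
  rw [eLpNorm_eq_ofReal_integral hp hkl]
  refine (ENNReal.ofReal_lt_ofReal_iff hε).2 ?_
  rw [Real.rpow_inv_lt_iff_of_pos (integral_nonneg fun x => by positivity) hε.le (by linarith)]
  have h1 := integrable_norm_rpow_of_memLp hp (hf k)
  have h2 := integrable_norm_rpow_of_memLp hp (hf l)
  have h3 := integrable_midpointDefect hp (hf k) (hf l)
  have h4 : Integrable (fun x => τ / (4 * (B + 1)) * (‖f k x‖ ^ p + ‖f l x‖ ^ p)) μ :=
    (h1.add h2).const_mul _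
  calc ∫ x, ‖(f k - f l) x‖ ^ p ∂μ
      ≤ ∫ x, (τ / (4 * (B + 1)) * (‖f k x‖ ^ p + ‖f l x‖ ^ p)
          + C * midpointDefect p (f k x) (f l x)) ∂μ :=
        integral_mono (integrable_norm_rpow_of_memLp hp hkl) (h4.add (h3.const_mul C))
          fun x => hC _ _
    _ = τ / (4 * (B + 1)) * ((∫ x, ‖f k x‖ ^ p ∂μ) + ∫ x, ‖f l x‖ ^ p ∂μ)
          + C * ∫ x, midpointDefect p (f k x) (f l x) ∂μ := by
        rw [integral_add h4 (h3.const_mul C), integral_const_mul, integral_const_mul,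
          integral_add h1 h2]
    _ ≤ τ / (4 * (B + 1)) * (B + B) + C * (τ / (4 * (C + 1))) := by
        gcongr
        · exact hB k
        · exact hB l
        · exact (hN k hk l hl).le
    _ < τ := by
        have e1 : τ / (4 * (B + 1)) * (B + B) ≤ τ / 2 := by
          rw [div_mul_eq_mul_div, div_le_div_iff₀ (by positivity) (by norm_num)]
          nlinarith
        have e2 : C * (τ / (4 * (C + 1))) ≤ τ / 4 := by
          rw [mul_div_assoc', div_le_div_iff₀ (by positivity) (by norm_num)]
          nlinarith
        linarith

/-- Almost minimizers of a nonnegative function over a decreasing sequence of convex sets have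
vanishing midpoint defects. -/
theorem exists_seq_of_antitone_convex {V : Type*} [AddCommGroup V] [Module ℝ V] {C : ℕ → Set V}
    (hC : Antitone C) (hconv : ∀ k, Convex ℝ (C k)) {Φ : V → ℝ} (h0 : ∀ z ∈ C 0, 0 ≤ Φ z)
    {B : ℕ → ℝ} (hB : ∀ k, ∃ z ∈ C k, Φ z ≤ B k) {b : ℝ} (hBb : ∀ k, B k ≤ b) :
    ∃ z : ℕ → V, (∀ k, z k ∈ C k) ∧ (∀ k, Φ (z k) ≤ B k + 1 / (k + 1)) ∧
      ∀ ε > 0, ∃ N, ∀ k ≥ N, ∀ l ≥ N,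
        (Φ (z k) + Φ (z l)) / 2 - Φ ((1 / 2 : ℝ) • (z k + z l)) < ε := by
  set d : ℕ → ℝ := fun k => sInf (Φ '' C k) with hd
  have hbdd : ∀ k, BddBelow (Φ '' C k) := fun k => by
    refine ⟨0, ?_⟩
    rintro _ ⟨z, hz, rfl⟩
    exact h0 z (hC (Nat.zero_le k) hz)
  have hne : ∀ k, (Φ '' C k).Nonempty := fun k => by
    obtain ⟨z, hz, -⟩ := hB k
    exact ⟨_, z, hz, rfl⟩
  have hdB : ∀ k, d k ≤ B k := fun k => by
    obtain ⟨z, hz, h⟩ := hB k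
    exact (csInf_le (hbdd k) ⟨z, hz, rfl⟩).trans h
  have hmono : Monotone d := fun k l hkl =>
    csInf_le_csInf (hbdd k) (hne l) (Set.image_mono (hC hkl))
  have hz : ∀ k : ℕ, ∃ z ∈ C k, Φ z < d k + 1 / ((k : ℝ) + 1) := fun k => by
    obtain ⟨_, ⟨z, hz, rfl⟩, h⟩ := exists_lt_of_csInf_lt (hne k)
      (show sInf (Φ '' C k) < d k + 1 / ((k : ℝ) + 1) from lt_add_of_pos_right _ (by positivity))
    exact ⟨z, hz, h⟩
  choose z hzC hzΦ using hz
  refine ⟨z, hzC, fun k => (hzΦ k).le.trans (by gcongr; exact hdB k), fun ε hε => ?_⟩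
  -- The infima increase because the sets shrink, and they are bounded by `b`. For k ≤ l the
  -- midpoint lies in `C k`, so its value is at least `d k`, while the mean of the two values
  -- exceeds `d k` by at most (d l - d k)/2 plus the mean of the two slacks.
  have hconvg : CauchySeq d :=
    (tendsto_atTop_ciSup hmono
      ⟨b, by rintro _ ⟨k, rfl⟩; exact (hdB k).trans (hBb k)⟩).cauchySeq
  obtain ⟨N₁, hN₁⟩ := Metric.cauchySeq_iff.1 hconvg (ε / 2) (by positivity)
  obtain ⟨N₂, hN₂⟩ := exists_nat_one_div_lt (show (0 : ℝ) < ε / 2 by positivity)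
  have main : ∀ k ≥ max N₁ N₂, ∀ l ≥ k,
      (Φ (z k) + Φ (z l)) / 2 - Φ ((1 / 2 : ℝ) • (z k + z l)) < ε := by
    intro k hk l hl
    have hmem : (1 / 2 : ℝ) • (z k + z l) ∈ C k := by
      rw [smul_add]
      exact hconv k (hzC k) (hC hl (hzC l)) (by norm_num) (by norm_num) (by norm_num)
    have h1 : d k ≤ Φ ((1 / 2 : ℝ) • (z k + z l)) := csInf_le (hbdd k) ⟨_, hmem, rfl⟩
    have h2 := hN₁ l ((le_max_left _ _).trans (hk.trans hl)) k ((le_max_left _ _).trans hk)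
    rw [Real.dist_eq] at h2
    have h3 := (abs_lt.1 h2).2
    have hinv : ∀ j ≥ N₂, 1 / ((j : ℝ) + 1) < ε / 2 := fun j hj =>
      lt_of_le_of_lt (one_div_le_one_div_of_le (by positivity) (by gcongr)) hN₂
    have h4 := hinv k ((le_max_right _ _).trans hk)
    have h5 := hinv l ((le_max_right _ _).trans (hk.trans hl))
    linarith [hzΦ k, hzΦ l]
  refine ⟨max N₁ N₂, fun k hk l hl => ?_⟩
  rcases le_total k l with h | h
  · exact main k hk l h
  · rw [add_comm (Φ (z k)), add_comm (z k)]
    exact main l hl k h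

/-! ### Linearity and uniqueness of weak gradients -/

section WeakGradientAlgebra

variable {n : ℕ} {Ω : Set (EuclideanSpace ℝ (Fin n))} {f f' : EuclideanSpace ℝ (Fin n) → ℝ}
  {G G' : EuclideanSpace ℝ (Fin n) → EuclideanSpace ℝ (Fin n)}

theorem IsTestFunction.integrableOn_smul_gradient {η : EuclideanSpace ℝ (Fin n) → ℝ}
    (hη : IsTestFunction Ω η) (hf : LocallyIntegrableOn f Ω) :
    IntegrableOn (fun x => f x • gradient η x) Ω := by
  have hK : IsCompact (tsupport η) := hη.hasCompactSupport
  have : IntegrableOn (fun x => f x • gradient η x) (tsupport η) :=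
    (hf.integrableOn_compact_subset hη.tsupport_subset hK).smul_continuousOn
      (continuous_gradient (hη.contDiff.of_le (by simp))).continuousOn hK
  refine ((integrableOn_iff_integrable_of_support_subset fun x hx => ?_).1 this).integrableOn
  by_contra h
  exact hx (by simp [gradient_eq_zero_of_notMem_tsupport h])

theorem IsTestFunction.integrableOn_smul {η : EuclideanSpace ℝ (Fin n) → ℝ}
    (hη : IsTestFunction Ω η) (hG : LocallyIntegrableOn G Ω) :
    IntegrableOn (fun x => η x • G x) Ω := by
  have hK : IsCompact (tsupport η) := hη.hasCompactSupport
  have : IntegrableOn (fun x => η x • G x) (tsupport η) :=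
    (hG.integrableOn_compact_subset hη.tsupport_subset hK).continuousOn_smul
      hη.contDiff.continuous.continuousOn hK
  refine ((integrableOn_iff_integrable_of_support_subset fun x hx => ?_).1 this).integrableOn
  by_contra h
  exact hx (by simp [image_eq_zero_of_notMem_tsupport h])

theorem HasWeakGradient.add (h : HasWeakGradient Ω f G) (h' : HasWeakGradient Ω f' G') :
    HasWeakGradient Ω (f + f') (G + G') where
  locallyIntegrableOn := h.locallyIntegrableOn.add h'.locallyIntegrableOn
  locallyIntegrableOn_grad := h.locallyIntegrableOn_grad.add h'.locallyIntegrableOn_grad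
  integral_eq η hη := by
    simp only [Pi.add_apply, add_smul, smul_add]
    rw [integral_add (hη.integrableOn_smul_gradient h.locallyIntegrableOn)
        (hη.integrableOn_smul_gradient h'.locallyIntegrableOn),
      integral_add (hη.integrableOn_smul h.locallyIntegrableOn_grad)
        (hη.integrableOn_smul h'.locallyIntegrableOn_grad),
      h.integral_eq η hη, h'.integral_eq η hη, neg_add]

theorem HasWeakGradient.const_smul (h : HasWeakGradient Ω f G) (c : ℝ) :
    HasWeakGradient Ω (c • f) (c • G) where
  locallyIntegrableOn := h.locallyIntegrableOn.smul c
  locallyIntegrableOn_grad := h.locallyIntegrableOn_grad.smul c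
  integral_eq η hη := by
    have e : ∀ x, η x • (c • G) x = c • (η x • G x) := fun x => by
      rw [Pi.smul_apply, smul_comm]
    simp_rw [e, Pi.smul_apply, smul_assoc]
    rw [integral_smul, integral_smul, h.integral_eq η hη, smul_neg]

theorem HasWeakGradient.neg (h : HasWeakGradient Ω f G) : HasWeakGradient Ω (-f) (-G) := by
  simpa using h.const_smul (-1)

theorem HasWeakGradient.sub (h : HasWeakGradient Ω f G) (h' : HasWeakGradient Ω f' G') :
    HasWeakGradient Ω (f - f') (G - G') := by
  simpa [sub_eq_add_neg] using h.add h'.neg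

theorem hasWeakGradient_weakGradient (h : HasWeakGradient Ω f G) :
    HasWeakGradient Ω f (weakGradient Ω f) := by
  have hex : ∃ G, HasWeakGradient Ω f G := ⟨G, h⟩
  rw [weakGradient, dif_pos hex]
  exact hex.choose_spec

theorem HasWeakGradient.weakGradient_ae_eq (hΩ : IsOpen Ω) (h : HasWeakGradient Ω f G) :
    weakGradient Ω f =ᵐ[volume.restrict Ω] G :=
  HasWeakGradient.ae_eq hΩ (hasWeakGradient_weakGradient h) h

end WeakGradientAlgebra

/-! ### Comparison of Lebesgue exponents and closedness of weak gradients -/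

theorem exists_eLpNorm_le_mul_of_exponent_le {α : Type*} [MeasurableSpace α] (μ : Measure α)
    [IsFiniteMeasure μ] (F : Type*) [NormedAddCommGroup F] {r s : ℝ≥0∞} (hr : 1 ≤ r)
    (hrs : r ≤ s) :
    ∃ c : ℝ≥0∞, c ≠ ⊤ ∧ ∀ f : α → F, AEStronglyMeasurable f μ →
      eLpNorm f r μ ≤ eLpNorm f s μ * c := by
  refine ⟨_, ?_, fun f hf => eLpNorm_le_eLpNorm_mul_rpow_measure_univ hrs hf⟩
  refine ENNReal.rpow_ne_top_of_nonneg ?_ (measure_ne_top μ _)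
  rcases eq_or_ne s ⊤ with rfl | hst
  · simp
  · have hrt : r ≠ ⊤ := ne_top_of_le_ne_top hst hrs
    have h1 : 0 < r.toReal := ENNReal.toReal_pos (by positivity) hrt
    have h2 := (ENNReal.toReal_le_toReal hrt hst).2 hrs
    linarith [one_div_le_one_div_of_le h1 h2]

theorem tendsto_eLpNorm_of_exponent_le {α F : Type*} [MeasurableSpace α] {μ : Measure α}
    [IsFiniteMeasure μ] [NormedAddCommGroup F] {r s : ℝ≥0∞} (hr : 1 ≤ r) (hrs : r ≤ s)
    {f : ℕ → α → F} (hf : ∀ k, AEStronglyMeasurable (f k) μ)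
    (h : Tendsto (fun k => eLpNorm (f k) s μ) atTop (𝓝 0)) :
    Tendsto (fun k => eLpNorm (f k) r μ) atTop (𝓝 0) := by
  obtain ⟨c, hc, hle⟩ := exists_eLpNorm_le_mul_of_exponent_le μ F hr hrs
  have h2 := ENNReal.Tendsto.mul_const h (Or.inr hc)
  rw [zero_mul] at h2
  exact tendsto_of_tendsto_of_tendsto_of_le_of_le tendsto_const_nhds h2 (fun _ => zero_le)
    fun k => hle _ (hf k)

/-- Hölder's inequality on a set of finite measure. It reduces convergence in any L^p to the local
L¹ convergence against test functions, so that functions and gradients may converge with different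
exponents. -/
theorem tendsto_setIntegral_norm_of_tendsto_eLpNorm {α F : Type*} [MeasurableSpace α]
    {μ : Measure α} [NormedAddCommGroup F] {p : ℝ≥0∞} (hp : 1 ≤ p) {Ω K : Set α} (hK : K ⊆ Ω)
    (hμ : μ K ≠ ⊤) {f : ℕ → α → F} (hf : ∀ k, AEStronglyMeasurable (f k) (μ.restrict Ω))
    (h : Tendsto (fun k => eLpNorm (f k) p (μ.restrict Ω)) atTop (𝓝 0)) :
    Tendsto (fun k => ∫ x in K, ‖f k x‖ ∂μ) atTop (𝓝 0) := by
  have hmeas : ∀ k, AEStronglyMeasurable (f k) (μ.restrict K) := fun k =>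
    (hf k).mono_measure (Measure.restrict_mono hK le_rfl)
  have e : ∀ k, ∫ x in K, ‖f k x‖ ∂μ = (eLpNorm (f k) 1 (μ.restrict K)).toReal := fun k => by
    rw [eLpNorm_one_eq_lintegral_enorm, integral_norm_eq_lintegral_enorm (hmeas k)]
  simp_rw [e]
  rw [← ENNReal.toReal_zero]
  refine (ENNReal.tendsto_toReal ENNReal.zero_ne_top).comp ?_
  have : IsFiniteMeasure (μ.restrict K) := ⟨by simpa using hμ.lt_top⟩
  refine tendsto_eLpNorm_of_exponent_le le_rfl hp hmeas ?_
  exact tendsto_of_tendsto_of_tendsto_of_le_of_le tendsto_const_nhds h (fun _ => zero_le)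
    fun k => eLpNorm_mono_measure _ (Measure.restrict_mono hK le_rfl)

theorem MemLp.locallyIntegrableOn {n : ℕ} {F : Type*} [NormedAddCommGroup F]
    {Ω : Set (EuclideanSpace ℝ (Fin n))} {p : ℝ≥0∞} (hp : 1 ≤ p)
    {f : EuclideanSpace ℝ (Fin n) → F} (hΩ : IsOpen Ω) (hf : MemLp f p (volume.restrict Ω)) :
    LocallyIntegrableOn f Ω := by
  refine (locallyIntegrableOn_iff hΩ.isLocallyClosed).2 fun K hK hKc => ?_
  have h1 : MemLp f p (volume.restrict K) := hf.mono_measure (Measure.restrict_mono hK le_rfl)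
  have : IsFiniteMeasure (volume.restrict K) := ⟨by simpa using hKc.measure_lt_top⟩
  exact h1.integrable hp

/-- Weak gradients are closed under convergence in Lebesgue spaces. -/
theorem hasWeakGradient_of_tendsto_eLpNorm {n : ℕ} {Ω : Set (EuclideanSpace ℝ (Fin n))}
    {p r : ℝ≥0∞} (hp : 1 ≤ p) (hr : 1 ≤ r)
    {u : ℕ → EuclideanSpace ℝ (Fin n) → ℝ}
    {g : ℕ → EuclideanSpace ℝ (Fin n) → EuclideanSpace ℝ (Fin n)}
    {f : EuclideanSpace ℝ (Fin n) → ℝ} {G : EuclideanSpace ℝ (Fin n) → EuclideanSpace ℝ (Fin n)}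
    (hw : ∀ k, HasWeakGradient Ω (u k) (g k))
    (hf : LocallyIntegrableOn f Ω) (hG : LocallyIntegrableOn G Ω)
    (h1 : Tendsto (fun k => eLpNorm (u k - f) p (volume.restrict Ω)) atTop (𝓝 0))
    (h2 : Tendsto (fun k => eLpNorm (g k - G) r (volume.restrict Ω)) atTop (𝓝 0)) :
    HasWeakGradient Ω f G := by
  refine hasWeakGradient_of_tendsto hf hG fun η hη => ⟨u, g, hw, ?_, ?_⟩
  · exact tendsto_setIntegral_norm_of_tendsto_eLpNorm hp hη.tsupport_subset
      (IsCompact.measure_lt_top hη.hasCompactSupport).ne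
      (fun k => ((hw k).locallyIntegrableOn.sub hf).aestronglyMeasurable) h1
  · exact tendsto_setIntegral_norm_of_tendsto_eLpNorm hr hη.tsupport_subset
      (IsCompact.measure_lt_top hη.hasCompactSupport).ne
      (fun k => ((hw k).locallyIntegrableOn_grad.sub hG).aestronglyMeasurable) h2

/-! ### Test functions -/

section TestFunctions

variable {n : ℕ} {Ω : Set (EuclideanSpace ℝ (Fin n))} {η ζ : EuclideanSpace ℝ (Fin n) → ℝ}

theorem IsTestFunction.add (hη : IsTestFunction Ω η) (hζ : IsTestFunction Ω ζ) :
    IsTestFunction Ω (η + ζ) :=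
  ⟨hη.contDiff.add hζ.contDiff, hη.hasCompactSupport.add hζ.hasCompactSupport,
    (tsupport_add η ζ).trans (Set.union_subset hη.tsupport_subset hζ.tsupport_subset)⟩

theorem IsTestFunction.const_smul (hη : IsTestFunction Ω η) (c : ℝ) :
    IsTestFunction Ω (c • η) :=
  ⟨contDiff_const.smul hη.contDiff, hη.hasCompactSupport.smul_left (f := fun _ => c),
    (tsupport_smul_subset_right (fun _ => c) η).trans hη.tsupport_subset⟩

theorem isTestFunction_zero : IsTestFunction Ω (0 : EuclideanSpace ℝ (Fin n) → ℝ) :=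
  ⟨contDiff_const, HasCompactSupport.zero, by simp [tsupport]⟩

theorem IsTestFunction.contDiff_one (hη : IsTestFunction Ω η) : ContDiff ℝ 1 η :=
  hη.contDiff.of_le (by simp)

theorem IsTestFunction.gradient_add (hη : IsTestFunction Ω η) (hζ : IsTestFunction Ω ζ) :
    gradient (η + ζ) = gradient η + gradient ζ := by
  funext x
  simp only [gradient, Pi.add_apply]
  rw [fderiv_add (hη.contDiff_one.differentiable (by simp)).differentiableAt
    (hζ.contDiff_one.differentiable (by simp)).differentiableAt, map_add]

theorem IsTestFunction.gradient_const_smul (hη : IsTestFunction Ω η) (c : ℝ) :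
    gradient (c • η) = c • gradient η := by
  funext x
  simp only [gradient, Pi.smul_apply]
  rw [fderiv_const_smul (hη.contDiff_one.differentiable (by simp)).differentiableAt, map_smul]

theorem IsTestFunction.hasCompactSupport_gradient (hη : IsTestFunction Ω η) :
    HasCompactSupport (gradient η) :=
  HasCompactSupport.intro' hη.hasCompactSupport (isClosed_tsupport η) fun _ hx =>
    gradient_eq_zero_of_notMem_tsupport hx

theorem IsTestFunction.support_gradient_subset (hη : IsTestFunction Ω η) :
    Function.support (gradient η) ⊆ Ω := fun _ hx => by
  by_contra h
  exact hx (gradient_eq_zero_of_notMem_tsupport fun h1 => h (hη.tsupport_subset h1))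

theorem IsTestFunction.memLp (hη : IsTestFunction Ω η) (p : ℝ≥0∞) : MemLp η p volume :=
  hη.contDiff.continuous.memLp_of_hasCompactSupport hη.hasCompactSupport

theorem IsTestFunction.memLp_gradient (hη : IsTestFunction Ω η) (p : ℝ≥0∞) :
    MemLp (gradient η) p volume :=
  (continuous_gradient hη.contDiff_one).memLp_of_hasCompactSupport hη.hasCompactSupport_gradient

end TestFunctions

/-! ### The space W₀^{1,p} -/

section SobolevZero

variable {n : ℕ} {Ω : Set (EuclideanSpace ℝ (Fin n))}

/-- Membership in `W₀^{1,p}`, expressed with an arbitrary weak gradient. -/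
theorem mem_sobolevSpaceZero_iff (hΩ : IsOpen Ω) {p : ℝ} {f : EuclideanSpace ℝ (Fin n) → ℝ} :
    f ∈ sobolevSpaceZero p Ω ↔ MemLp f (ENNReal.ofReal p) (volume.restrict Ω) ∧
      ∃ G, HasWeakGradient Ω f G ∧ MemLp G (ENNReal.ofReal p) (volume.restrict Ω) ∧
        ∃ η : ℕ → EuclideanSpace ℝ (Fin n) → ℝ, (∀ k, IsTestFunction Ω (η k)) ∧
          Tendsto (fun k => eLpNorm (f - η k) (ENNReal.ofReal p) (volume.restrict Ω))
            atTop (𝓝 0) ∧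
          Tendsto (fun k => eLpNorm (G - gradient (η k)) (ENNReal.ofReal p)
            (volume.restrict Ω)) atTop (𝓝 0) := by
  constructor
  · rintro ⟨⟨h1, G, h2, h3⟩, η, h4, h5, h6⟩
    exact ⟨h1, weakGradient Ω f, hasWeakGradient_weakGradient h2,
      (memLp_congr_ae (h2.weakGradient_ae_eq hΩ)).2 h3, η, h4, h5, h6⟩
  · rintro ⟨h1, G, h2, h3, η, h4, h5, h6⟩
    refine ⟨⟨h1, G, h2, h3⟩, η, h4, h5, h6.congr fun k => eLpNorm_congr_ae ?_⟩
    filter_upwards [h2.weakGradient_ae_eq hΩ] with x hx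
    simp [hx]

theorem zero_mem_sobolevSpaceZero (hΩ : IsOpen Ω) (p : ℝ) :
    (0 : EuclideanSpace ℝ (Fin n) → ℝ) ∈ sobolevSpaceZero p Ω := by
  have h0 : gradient (0 : EuclideanSpace ℝ (Fin n) → ℝ) = 0 := by
    funext x
    simp [gradient]
  refine (mem_sobolevSpaceZero_iff hΩ).2 ⟨MemLp.zero', gradient 0,
    hasWeakGradient_of_contDiff Ω contDiff_const, by rw [h0]; exact MemLp.zero', fun _ => 0,
    fun _ => isTestFunction_zero, by simp, by simp⟩

theorem add_mem_sobolevSpaceZero (hΩ : IsOpen Ω) {p : ℝ} (hp : 1 ≤ p)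
    {f g : EuclideanSpace ℝ (Fin n) → ℝ} (hf : f ∈ sobolevSpaceZero p Ω)
    (hg : g ∈ sobolevSpaceZero p Ω) : f + g ∈ sobolevSpaceZero p Ω := by
  rw [mem_sobolevSpaceZero_iff hΩ] at hf hg ⊢
  obtain ⟨h1, G, h2, h3, η, h4, h5, h6⟩ := hf
  obtain ⟨k1, H, k2, k3, ζ, k4, k5, k6⟩ := hg
  have hp' : 1 ≤ ENNReal.ofReal p := by simpa using hp
  refine ⟨h1.add k1, G + H, h2.add k2, h3.add k3, fun k => η k + ζ k,
    fun k => (h4 k).add (k4 k), ?_, ?_⟩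
  · refine tendsto_of_tendsto_of_tendsto_of_le_of_le tendsto_const_nhds (by simpa using h5.add k5)
      (fun _ => zero_le) fun k => ?_
    rw [add_sub_add_comm]
    exact eLpNorm_add_le (h1.sub (((h4 k).memLp _).restrict Ω)).aestronglyMeasurable
      (k1.sub (((k4 k).memLp _).restrict Ω)).aestronglyMeasurable hp'
  · refine tendsto_of_tendsto_of_tendsto_of_le_of_le tendsto_const_nhds (by simpa using h6.add k6)
      (fun _ => zero_le) fun k => ?_
    rw [(h4 k).gradient_add (k4 k), add_sub_add_comm]
    exact eLpNorm_add_le (h3.sub (((h4 k).memLp_gradient _).restrict Ω)).aestronglyMeasurable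
      (k3.sub (((k4 k).memLp_gradient _).restrict Ω)).aestronglyMeasurable hp'

theorem const_smul_mem_sobolevSpaceZero (hΩ : IsOpen Ω) {p : ℝ}
    {f : EuclideanSpace ℝ (Fin n) → ℝ} (hf : f ∈ sobolevSpaceZero p Ω) (c : ℝ) :
    c • f ∈ sobolevSpaceZero p Ω := by
  rw [mem_sobolevSpaceZero_iff hΩ] at hf ⊢
  obtain ⟨h1, G, h2, h3, η, h4, h5, h6⟩ := hf
  refine ⟨h1.const_smul c, c • G, h2.const_smul c, h3.const_smul c, fun k => c • η k,
    fun k => (h4 k).const_smul c, ?_, ?_⟩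
  · simp_rw [← smul_sub, eLpNorm_const_smul]
    simpa using ENNReal.Tendsto.const_mul h5 (Or.inr enorm_ne_top)
  · simp_rw [(h4 _).gradient_const_smul, ← smul_sub, eLpNorm_const_smul]
    simpa using ENNReal.Tendsto.const_mul h6 (Or.inr enorm_ne_top)

theorem sobolevSpace_subset_of_le (hΩm : volume Ω ≠ ⊤) {r s : ℝ} (hrs : r ≤ s) :
    sobolevSpace s Ω ⊆ sobolevSpace r Ω := by
  have : IsFiniteMeasure (volume.restrict Ω) := ⟨by simpa using hΩm.lt_top⟩
  rintro f ⟨h1, G, h2, h3⟩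
  have h := ENNReal.ofReal_le_ofReal hrs
  exact ⟨h1.mono_exponent h, G, h2, h3.mono_exponent h⟩

theorem sobolevSpaceZero_subset_of_le (hΩ : IsOpen Ω) (hΩm : volume Ω ≠ ⊤) {r s : ℝ} (hr : 1 ≤ r)
    (hrs : r ≤ s) : sobolevSpaceZero s Ω ⊆ sobolevSpaceZero r Ω := by
  have : IsFiniteMeasure (volume.restrict Ω) := ⟨by simpa using hΩm.lt_top⟩
  intro f hf
  rw [mem_sobolevSpaceZero_iff hΩ] at hf ⊢
  obtain ⟨h1, G, h2, h3, η, h4, h5, h6⟩ := hf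
  have h := ENNReal.ofReal_le_ofReal hrs
  have hr' : 1 ≤ ENNReal.ofReal r := by simpa using hr
  exact ⟨h1.mono_exponent h, G, h2, h3.mono_exponent h, η, h4,
    tendsto_eLpNorm_of_exponent_le hr' h
      (fun k => (h1.sub (((h4 k).memLp _).restrict Ω)).aestronglyMeasurable) h5,
    tendsto_eLpNorm_of_exponent_le hr' h
      (fun k => (h3.sub (((h4 k).memLp_gradient _).restrict Ω)).aestronglyMeasurable) h6⟩

/-- Test functions approximate any element of `W₀^{1,p}` arbitrarily well. -/
theorem exists_isTestFunction_eLpNorm_sub_lt (hΩ : IsOpen Ω) {p : ℝ}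
    {f : EuclideanSpace ℝ (Fin n) → ℝ} (hf : f ∈ sobolevSpaceZero p Ω)
    {G : EuclideanSpace ℝ (Fin n) → EuclideanSpace ℝ (Fin n)} (hG : HasWeakGradient Ω f G)
    {ε : ℝ≥0∞} (hε : 0 < ε) :
    ∃ η, IsTestFunction Ω η ∧ eLpNorm (f - η) (ENNReal.ofReal p) (volume.restrict Ω) < ε ∧
      eLpNorm (G - gradient η) (ENNReal.ofReal p) (volume.restrict Ω) < ε := by
  obtain ⟨-, G', h2, -, η, h4, h5, h6⟩ := (mem_sobolevSpaceZero_iff hΩ).1 hf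
  obtain ⟨k, hk5, hk6⟩ := ((h5.eventually (gt_mem_nhds hε)).and
    (h6.eventually (gt_mem_nhds hε))).exists
  refine ⟨η k, h4 k, hk5, lt_of_eq_of_lt (eLpNorm_congr_ae ?_) hk6⟩
  filter_upwards [HasWeakGradient.ae_eq hΩ hG h2] with x hx
  simp [hx]

theorem memLp_of_mem_sobolevSpaceZero (hΩ : IsOpen Ω) {p : ℝ}
    {f : EuclideanSpace ℝ (Fin n) → ℝ} (hf : f ∈ sobolevSpaceZero p Ω)
    {G : EuclideanSpace ℝ (Fin n) → EuclideanSpace ℝ (Fin n)} (hG : HasWeakGradient Ω f G) :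
    MemLp G (ENNReal.ofReal p) (volume.restrict Ω) := by
  obtain ⟨-, G', h2, h3, -⟩ := (mem_sobolevSpaceZero_iff hΩ).1 hf
  exact (memLp_congr_ae (HasWeakGradient.ae_eq hΩ hG h2)).2 h3

/-- `W₀^{1,p}` is closed under convergence in `W^{1,p}`. -/
theorem mem_sobolevSpaceZero_of_tendsto (hΩ : IsOpen Ω) {p : ℝ} (hp : 1 ≤ p)
    {u : ℕ → EuclideanSpace ℝ (Fin n) → ℝ}
    {g : ℕ → EuclideanSpace ℝ (Fin n) → EuclideanSpace ℝ (Fin n)}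
    {f : EuclideanSpace ℝ (Fin n) → ℝ} {G : EuclideanSpace ℝ (Fin n) → EuclideanSpace ℝ (Fin n)}
    (hu : ∀ k, u k ∈ sobolevSpaceZero p Ω) (hw : ∀ k, HasWeakGradient Ω (u k) (g k))
    (hf : MemLp f (ENNReal.ofReal p) (volume.restrict Ω))
    (hG : MemLp G (ENNReal.ofReal p) (volume.restrict Ω))
    (h1 : Tendsto (fun k => eLpNorm (u k - f) (ENNReal.ofReal p) (volume.restrict Ω))
      atTop (𝓝 0))
    (h2 : Tendsto (fun k => eLpNorm (g k - G) (ENNReal.ofReal p) (volume.restrict Ω))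
      atTop (𝓝 0)) :
    f ∈ sobolevSpaceZero p Ω := by
  have hp' : 1 ≤ ENNReal.ofReal p := by simpa using hp
  have hε : ∀ k : ℕ, (0 : ℝ≥0∞) < ((k : ℝ≥0∞) + 1)⁻¹ := fun k => by
    rw [ENNReal.inv_pos]
    exact ENNReal.add_ne_top.2 ⟨ENNReal.natCast_ne_top k, ENNReal.one_ne_top⟩
  have hεt : Tendsto (fun k : ℕ => ((k : ℝ≥0∞) + 1)⁻¹) atTop (𝓝 0) := by
    have := (ENNReal.tendsto_inv_nat_nhds_zero).comp (tendsto_add_atTop_nat 1)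
    refine this.congr fun k => ?_
    simp
  choose η h3 h4 h5 using fun k => exists_isTestFunction_eLpNorm_sub_lt hΩ (hu k) (hw k) (hε k)
  have humem : ∀ k, MemLp (u k) (ENNReal.ofReal p) (volume.restrict Ω) := fun k =>
    ((mem_sobolevSpaceZero_iff hΩ).1 (hu k)).1
  have hgmem : ∀ k, MemLp (g k) (ENNReal.ofReal p) (volume.restrict Ω) := fun k =>
    memLp_of_mem_sobolevSpaceZero hΩ (hu k) (hw k)
  refine (mem_sobolevSpaceZero_iff hΩ).2 ⟨hf, G, hasWeakGradient_of_tendsto_eLpNorm hp' hp' hw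
    (MemLp.locallyIntegrableOn hp' hΩ hf) (MemLp.locallyIntegrableOn hp' hΩ hG) h1 h2, hG, η, h3,
    ?_, ?_⟩
  · refine tendsto_of_tendsto_of_tendsto_of_le_of_le tendsto_const_nhds
      (by simpa using h1.add hεt) (fun _ => zero_le) fun k => ?_
    have e : f - η k = (f - u k) + (u k - η k) := by abel
    rw [e]
    refine (eLpNorm_add_le (hf.sub (humem k)).aestronglyMeasurable
      ((humem k).sub (((h3 k).memLp _).restrict Ω)).aestronglyMeasurable hp').trans ?_
    rw [eLpNorm_sub_comm]
    exact add_le_add le_rfl (h4 k).le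
  · refine tendsto_of_tendsto_of_tendsto_of_le_of_le tendsto_const_nhds
      (by simpa using h2.add hεt) (fun _ => zero_le) fun k => ?_
    have e : G - gradient (η k) = (G - g k) + (g k - gradient (η k)) := by abel
    rw [e]
    refine (eLpNorm_add_le (hG.sub (hgmem k)).aestronglyMeasurable
      ((hgmem k).sub (((h3 k).memLp_gradient _).restrict Ω)).aestronglyMeasurable hp').trans ?_
    rw [eLpNorm_sub_comm]
    exact add_le_add le_rfl (h5 k).le

end SobolevZero

/-! ### Jensen's inequality and L^p norms of averages -/

theorem eLpNorm_ofReal_rpow {α F : Type*} [MeasurableSpace α] {μ : Measure α}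
    [NormedAddCommGroup F] {p : ℝ} (hp : 0 < p) (f : α → F) :
    eLpNorm f (ENNReal.ofReal p) μ ^ p = ∫⁻ x, ‖f x‖ₑ ^ p ∂μ := by
  rw [eLpNorm_eq_lintegral_rpow_enorm_toReal (by simpa using hp) ENNReal.ofReal_ne_top,
    ENNReal.toReal_ofReal hp.le, ← ENNReal.rpow_mul, one_div, inv_mul_cancel₀ hp.ne',
    ENNReal.rpow_one]

/-- Jensen's inequality for `t ↦ t ^ p`. -/
theorem lintegral_rpow_le_lintegral_rpow {Y : Type*} [MeasurableSpace Y] {ν : Measure Y}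
    [IsProbabilityMeasure ν] {p : ℝ} (hp : 1 ≤ p) {f : Y → ℝ≥0∞} (hf : AEMeasurable f ν) :
    (∫⁻ y, f y ∂ν) ^ p ≤ ∫⁻ y, f y ^ p ∂ν := by
  have hp0 : 0 < p := by linarith
  -- On a probability space Jensen's inequality is the monotonicity of the norms between the
  -- exponents 1 and `p`.
  have := eLpNorm'_le_eLpNorm'_of_exponent_le zero_lt_one hp ν hf.aestronglyMeasurable
  simp only [eLpNorm', enorm_eq_self, ENNReal.rpow_one, div_one] at this
  calc (∫⁻ y, f y ∂ν) ^ p ≤ ((∫⁻ y, f y ^ p ∂ν) ^ (1 / p)) ^ p := by gcongr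
    _ = ∫⁻ y, f y ^ p ∂ν := by
      rw [← ENNReal.rpow_mul, one_div, inv_mul_cancel₀ hp0.ne', ENNReal.rpow_one]

/-- The `L^p` norm of a function dominated by an average is at most the largest `L^p` norm of the
averaged functions. -/
theorem eLpNorm_le_of_enorm_le_lintegral {X Y F : Type*} [MeasurableSpace X] [MeasurableSpace Y]
    [NormedAddCommGroup F] {μ : Measure X} [SFinite μ] {ν : Measure Y} [IsProbabilityMeasure ν]
    {p : ℝ} (hp : 1 ≤ p) {f : X → F} {k : X → Y → ℝ≥0∞} (hk : Measurable (Function.uncurry k))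
    (hf : ∀ x, ‖f x‖ₑ ≤ ∫⁻ y, k x y ∂ν) {M : ℝ≥0∞}
    (hM : ∀ᵐ y ∂ν, ∫⁻ x, k x y ^ p ∂μ ≤ M ^ p) :
    eLpNorm f (ENNReal.ofReal p) μ ≤ M := by
  have hp0 : 0 < p := by linarith
  rw [← ENNReal.rpow_le_rpow_iff hp0, eLpNorm_ofReal_rpow hp0]
  calc ∫⁻ x, ‖f x‖ₑ ^ p ∂μ ≤ ∫⁻ x, ∫⁻ y, k x y ^ p ∂ν ∂μ := by
        refine lintegral_mono fun x => (ENNReal.rpow_le_rpow (hf x) hp0.le).trans ?_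
        exact lintegral_rpow_le_lintegral_rpow hp (hk.of_uncurry_left).aemeasurable
    _ = ∫⁻ y, ∫⁻ x, k x y ^ p ∂μ ∂ν :=
        lintegral_lintegral_swap (hk.pow_const p).aemeasurable
    _ ≤ ∫⁻ _, M ^ p ∂ν := lintegral_mono_ae hM
    _ = M ^ p := by simp

/-! ### Translation estimates, Poincaré inequality and Rellich compactness -/

section Rellich

variable {n : ℕ} {Ω : Set (EuclideanSpace ℝ (Fin n))}

/-- Translations of a compactly supported function in `L^p` are controlled by its gradient. -/
theorem IsTestFunction.eLpNorm_translate_sub_le {η : EuclideanSpace ℝ (Fin n) → ℝ}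
    (hη : IsTestFunction Ω η) {p : ℝ} (hp : 1 ≤ p) (h : EuclideanSpace ℝ (Fin n)) :
    eLpNorm (fun x => η (x + h) - η x) (ENNReal.ofReal p) volume
      ≤ ‖h‖ₑ * eLpNorm (gradient η) (ENNReal.ofReal p) volume := by
  have hp0 : 0 < p := by linarith
  have hg := continuous_gradient hη.contDiff_one
  have hcont : Continuous fun z : EuclideanSpace ℝ (Fin n) × ℝ => gradient η (z.1 + z.2 • h) :=
    hg.comp (by fun_prop)
  have : IsProbabilityMeasure (volume.restrict (Set.Ioc (0 : ℝ) 1)) := ⟨by simp⟩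
  -- The difference η(x + h) - η(x) is the average over t ∈ (0, 1] of ⟨∇η(x + th), h⟩. By
  -- translation invariance, for each `t` the L^p norm of the dominating function is |h| ‖∇η‖_p.
  refine eLpNorm_le_of_enorm_le_lintegral (ν := volume.restrict (Set.Ioc (0 : ℝ) 1)) hp
    (k := fun x t => ‖h‖ₑ * ‖gradient η (x + t • h)‖ₑ) ?_ (fun x => ?_)
    (Eventually.of_forall fun t => ?_)
  · exact (hcont.measurable.enorm).const_mul _
  · have hd : ∀ t : ℝ, HasDerivAt (fun t : ℝ => η (x + t • h)) (inner ℝ (gradient η (x + t • h)) h)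
        t := fun t => by
      have h1 : HasFDerivAt η (fderiv ℝ η (x + t • h)) (x + t • h) :=
        (hη.contDiff_one.differentiable (by simp)).differentiableAt.hasFDerivAt
      have h2 : HasDerivAt (fun t : ℝ => x + t • h) h t := by
        simpa using ((hasDerivAt_id t).smul_const h).const_add x
      rw [inner_gradient_left]
      exact h1.comp_hasDerivAt t h2
    have hc : Continuous fun t : ℝ => inner ℝ (gradient η (x + t • h)) h :=
      (hg.comp (by fun_prop)).inner continuous_const
    have e := intervalIntegral.integral_eq_sub_of_hasDerivAt (a := 0) (b := 1)
      (fun t _ => hd t) (hc.intervalIntegrable 0 1)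
    simp only [one_smul, zero_smul, add_zero] at e
    rw [← e, intervalIntegral.integral_of_le zero_le_one]
    refine (enorm_integral_le_lintegral_enorm _).trans (lintegral_mono fun t => ?_)
    rw [mul_comm, ← ofReal_norm, ← ofReal_norm, ← ofReal_norm,
      ← ENNReal.ofReal_mul (norm_nonneg _)]
    exact ENNReal.ofReal_le_ofReal (norm_inner_le_norm _ _)
  · have hm : Measurable fun x => ‖gradient η (x + t • h)‖ₑ ^ p :=
      (hg.comp (by fun_prop : Continuous fun x => x + t • h)).measurable.enorm.pow_const p
    simp_rw [ENNReal.mul_rpow_of_nonneg _ _ hp0.le]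
    rw [lintegral_const_mul _ hm, eLpNorm_ofReal_rpow hp0,
      lintegral_add_right_eq_self (fun x => ‖gradient η x‖ₑ ^ p) (t • h)]

/-- Poincaré inequality: if the translate of `Ω` by `h` is disjoint from `Ω`, then the norm of a
test function is controlled by that of its gradient. -/
theorem IsTestFunction.eLpNorm_le_mul_eLpNorm_gradient {η : EuclideanSpace ℝ (Fin n) → ℝ}
    (hη : IsTestFunction Ω η) {p : ℝ} (hp : 1 ≤ p) {h : EuclideanSpace ℝ (Fin n)}
    (hh : ∀ x ∈ Ω, x + h ∉ Ω) :
    eLpNorm η (ENNReal.ofReal p) volume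
      ≤ ‖h‖ₑ * eLpNorm (gradient η) (ENNReal.ofReal p) volume := by
  have h0 : ∀ x, x ∉ Ω → η x = 0 := fun x hx =>
    image_eq_zero_of_notMem_tsupport fun h1 => hx (hη.tsupport_subset h1)
  -- On `Ω` the translated function vanishes, so |η(x)| = |η(x + h) - η(x)| there; off `Ω` the left
  -- side is 0.
  refine (eLpNorm_mono fun x => ?_).trans (hη.eLpNorm_translate_sub_le hp h)
  by_cases hx : x ∈ Ω
  · rw [h0 _ (hh x hx), zero_sub, norm_neg]
  · simp [h0 x hx]

/-- A shift longer than the diameter of a surrounding ball moves `Ω` off itself. The absolute value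
of `R` covers an empty `Ω`, for which `R` may be negative. -/
theorem exists_forall_add_notMem (hn : 0 < n) (hΩ : Bornology.IsBounded Ω) :
    ∃ h : EuclideanSpace ℝ (Fin n), ∀ x ∈ Ω, x + h ∉ Ω := by
  obtain ⟨R, hR⟩ := hΩ.subset_closedBall 0
  refine ⟨EuclideanSpace.single ⟨0, hn⟩ (2 * |R| + 1), fun x hx hxh => ?_⟩
  have h1 : ‖x‖ ≤ R := by simpa using hR hx
  have h2 : ‖x + EuclideanSpace.single ⟨0, hn⟩ (2 * |R| + 1)‖ ≤ R := by simpa using hR hxh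
  have h3 := norm_sub_le (x + EuclideanSpace.single ⟨0, hn⟩ (2 * |R| + 1)) x
  rw [add_sub_cancel_left, PiLp.norm_single, Real.norm_eq_abs,
    abs_of_nonneg (by positivity)] at h3
  linarith [le_abs_self R]

/-- The average of `w` over the translates given by a probability measure `ν`. -/
noncomputable def translateAverage (ν : Measure (EuclideanSpace ℝ (Fin n)))
    (w : EuclideanSpace ℝ (Fin n) → ℝ) (x : EuclideanSpace ℝ (Fin n)) : ℝ :=
  ∫ h, w (x + h) ∂ν

variable {ν : Measure (EuclideanSpace ℝ (Fin n))} {η : EuclideanSpace ℝ (Fin n) → ℝ}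

theorem IsTestFunction.integrable_translate [IsProbabilityMeasure ν] (hη : IsTestFunction Ω η)
    (x : EuclideanSpace ℝ (Fin n)) : Integrable (fun h => η (x + h)) ν := by
  obtain ⟨C, hC⟩ := hη.hasCompactSupport.exists_bound_of_continuous hη.contDiff.continuous
  exact Integrable.of_bound
    (hη.contDiff.continuous.comp (by fun_prop)).aestronglyMeasurable C
    (Eventually.of_forall fun h => hC _)

/-- Averaging the translation estimate over short shifts: the error depends on `η` only through its
gradient, hence is uniform over a family with bounded gradients. -/
theorem IsTestFunction.eLpNorm_translateAverage_sub_le [IsProbabilityMeasure ν]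
    (hη : IsTestFunction Ω η) {p : ℝ} (hp : 1 ≤ p) {ε : ℝ≥0∞} (hν : ∀ᵐ h ∂ν, ‖h‖ₑ ≤ ε) :
    eLpNorm (translateAverage ν η - η) (ENNReal.ofReal p) volume
      ≤ ε * eLpNorm (gradient η) (ENNReal.ofReal p) volume := by
  have hp0 : 0 < p := by linarith
  have hc := hη.contDiff.continuous
  refine eLpNorm_le_of_enorm_le_lintegral (ν := ν) hp (k := fun x h => ‖η (x + h) - η x‖ₑ)
    ?_ (fun x => ?_) ?_
  · have : Continuous fun z : EuclideanSpace ℝ (Fin n) × EuclideanSpace ℝ (Fin n) =>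
        η (z.1 + z.2) - η z.1 := (hc.comp (by fun_prop)).sub (hc.comp (by fun_prop))
    exact this.measurable.enorm
  · have e : (translateAverage ν η - η) x = ∫ h, (η (x + h) - η x) ∂ν := by
      rw [integral_sub (hη.integrable_translate x) (integrable_const _)]
      simp [translateAverage]
    rw [e]
    exact enorm_integral_le_lintegral_enorm _
  · filter_upwards [hν] with h hh
    rw [← eLpNorm_ofReal_rpow hp0 fun x => η (x + h) - η x]
    gcongr
    exact (hη.eLpNorm_translate_sub_le hp h).trans (by gcongr)

theorem enorm_translateAverage_le {c : ℝ≥0∞} (hν : ν ≤ c • volume)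
    (w : EuclideanSpace ℝ (Fin n) → ℝ) (x : EuclideanSpace ℝ (Fin n)) :
    ‖translateAverage ν w x‖ₑ ≤ c * eLpNorm w 1 volume := by
  refine (enorm_integral_le_lintegral_enorm _).trans ((lintegral_mono' hν le_rfl).trans ?_)
  rw [lintegral_smul_measure, eLpNorm_one_eq_lintegral_enorm, smul_eq_mul,
    lintegral_add_left_eq_self (fun h => ‖w h‖ₑ) x]

/-- A bounded density turns an L¹ bound into a pointwise one: the difference at `x` and `y` is at
most `c` times the L¹ norm of η(· + x - y) - η, to which the translation estimate applies. -/
theorem IsTestFunction.enorm_translateAverage_sub_le [IsProbabilityMeasure ν] {c : ℝ≥0∞}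
    (hν : ν ≤ c • volume) (hη : IsTestFunction Ω η) (x y : EuclideanSpace ℝ (Fin n)) :
    ‖translateAverage ν η x - translateAverage ν η y‖ₑ
      ≤ c * eLpNorm (gradient η) 1 volume * ‖x - y‖ₑ := by
  rw [translateAverage, translateAverage,
    ← integral_sub (hη.integrable_translate x) (hη.integrable_translate y)]
  refine (enorm_integral_le_lintegral_enorm _).trans ((lintegral_mono' hν le_rfl).trans ?_)
  have e : ∀ h, ‖η (x + h) - η (y + h)‖ₑ
      = (fun z => ‖η (z + (x - y)) - η z‖ₑ) (y + h) := fun h => by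
    simp only
    congr 3
    abel
  simp_rw [e]
  rw [lintegral_smul_measure, smul_eq_mul, mul_assoc,
    lintegral_add_left_eq_self (fun z => ‖η (z + (x - y)) - η z‖ₑ) y]
  gcongr
  have := hη.eLpNorm_translate_sub_le le_rfl (x - y)
  rwa [ENNReal.ofReal_one, eLpNorm_one_eq_lintegral_enorm, mul_comm] at this

/-- Normalized Lebesgue measure on a ball, with `c` the reciprocal of its volume. The bound
degenerates as ε → 0, which is harmless since each radius is treated separately. -/
theorem exists_isProbabilityMeasure_le_smul_volume (n : ℕ) {ε : ℝ} (hε : 0 < ε) :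
    ∃ (ν : Measure (EuclideanSpace ℝ (Fin n))) (c : ℝ≥0∞), IsProbabilityMeasure ν ∧ c ≠ ⊤ ∧
      ν ≤ c • volume ∧ ∀ᵐ h ∂ν, ‖h‖ₑ ≤ ENNReal.ofReal ε := by
  have h0 : volume (Metric.ball (0 : EuclideanSpace ℝ (Fin n)) ε) ≠ 0 :=
    (Metric.measure_ball_pos volume _ hε).ne'
  refine ⟨ProbabilityTheory.cond volume (Metric.ball 0 ε), (volume (Metric.ball 0 ε))⁻¹,
    ProbabilityTheory.cond_isProbabilityMeasure_of_finite h0 measure_ball_lt_top.ne,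
    ENNReal.inv_ne_top.2 h0, ?_, ?_⟩
  · rw [ProbabilityTheory.cond]
    gcongr
    exact Measure.restrict_le_self
  · filter_upwards [ProbabilityTheory.ae_cond_mem (μ := volume)
      (Metric.isOpen_ball (x := (0 : EuclideanSpace ℝ (Fin n))) (ε := ε)).measurableSet] with h hh
    rw [← ofReal_norm]
    exact ENNReal.ofReal_le_ofReal (by simpa using (Metric.mem_ball.1 hh).le)

theorem tendsto_eLpNorm_of_bounded {α : Type*} [MeasurableSpace α] {μ : Measure α}
    [IsFiniteMeasure μ] {p : ℝ} (hp : 0 < p) {f : ℕ → α → ℝ} {g : α → ℝ}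
    (hf : ∀ k, AEStronglyMeasurable (f k) μ) {b : ℝ≥0∞} (hb : b ≠ ⊤)
    (hfb : ∀ k x, ‖f k x - g x‖ₑ ≤ b) (hlim : ∀ x, Tendsto (fun k => f k x) atTop (𝓝 (g x))) :
    Tendsto (fun k => eLpNorm (f k - g) (ENNReal.ofReal p) μ) atTop (𝓝 0) := by
  have hg : AEStronglyMeasurable g μ :=
    aestronglyMeasurable_of_tendsto_ae atTop hf (Eventually.of_forall hlim)
  have key : Tendsto (fun k => ∫⁻ x, ‖f k x - g x‖ₑ ^ p ∂μ) atTop (𝓝 (∫⁻ _, 0 ∂μ)) := by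
    refine tendsto_lintegral_of_dominated_convergence' (fun _ => b ^ p)
      (fun k => (((hf k).sub hg).enorm).pow_const p)
      (fun k => Eventually.of_forall fun x => ENNReal.rpow_le_rpow (hfb k x) hp.le) ?_
      (Eventually.of_forall fun x => ?_)
    · rw [lintegral_const]
      exact ENNReal.mul_ne_top (ENNReal.rpow_ne_top_of_nonneg hp.le hb) (measure_ne_top μ _)
    · have h1 : Tendsto (fun k => ‖f k x - g x‖ₑ) atTop (𝓝 0) := by
        have := ((hlim x).sub_const (g x)).enorm
        simpa using this
      have := (ENNReal.continuous_rpow_const (y := p)).tendsto 0 |>.comp h1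
      rw [ENNReal.zero_rpow_of_pos hp] at this
      exact this
  rw [lintegral_zero] at key
  have h2 := (ENNReal.continuous_rpow_const (y := 1 / p)).tendsto 0 |>.comp key
  rw [ENNReal.zero_rpow_of_pos (by positivity)] at h2
  refine h2.congr fun k => ?_
  rw [Function.comp_apply, eLpNorm_eq_lintegral_rpow_enorm_toReal (by simpa using hp)
    ENNReal.ofReal_ne_top, ENNReal.toReal_ofReal hp.le]
  rfl

end Rellich

/-- A sequence of functions on a separable space that is pointwise bounded and uniformly Lipschitz,
for each of countably many operators, has a subsequence converging pointwise for all of them. -/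
theorem exists_subseq_tendsto_of_lipschitz {X : Type*} [PseudoMetricSpace X]
    [TopologicalSpace.SeparableSpace X] [Nonempty X] {a : ℕ → ℕ → X → ℝ} {b L : ℕ → ℝ}
    (hb : ∀ i k x, |a i k x| ≤ b i) (hL : ∀ i k x y, |a i k x - a i k y| ≤ L i * dist x y) :
    ∃ φ : ℕ → ℕ, StrictMono φ ∧
      ∃ l : ℕ → X → ℝ, ∀ i x, Tendsto (fun k => a i (φ k) x) atTop (𝓝 (l i x)) := by
  set D := TopologicalSpace.denseSeq X
  -- Compactness of a countable product of intervals replaces the diagonal argument: one subsequence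
  -- serves all indices `i` and all points of the dense sequence. The Lipschitz bound then carries
  -- convergence to every point.
  have hc : IsCompact (Set.univ.pi fun z : ℕ × ℕ => Set.Icc (-b z.1) (b z.1)) :=
    isCompact_univ_pi fun _ => isCompact_Icc
  obtain ⟨s, -, φ, hφ, hs⟩ := hc.tendsto_subseq (x := fun k z => a z.1 k (D z.2))
    fun k z _ => Set.mem_Icc.2 (abs_le.1 (hb _ _ _))
  have hs' : ∀ i j, Tendsto (fun k => a i (φ k) (D j)) atTop (𝓝 (s (i, j))) := fun i j =>
    (tendsto_pi_nhds.1 hs) (i, j)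
  have hcau : ∀ i x, CauchySeq fun k => a i (φ k) x := by
    intro i x
    rw [Metric.cauchySeq_iff]
    intro ε hε
    obtain ⟨j, hj⟩ : ∃ j, dist x (D j) < ε / (3 * (|L i| + 1)) :=
      Metric.mem_closure_range_iff.1
        ((TopologicalSpace.denseRange_denseSeq X) x) (ε / (3 * (|L i| + 1))) (by positivity)
    have hLj : L i * dist x (D j) ≤ ε / 3 := by
      rw [lt_div_iff₀ (by positivity)] at hj
      nlinarith [le_abs_self (L i), dist_nonneg (x := x) (y := D j)]
    obtain ⟨N, hN⟩ := Metric.cauchySeq_iff.1 (hs' i j).cauchySeq (ε / 3) (by positivity)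
    refine ⟨N, fun k hk l hl => ?_⟩
    have h1 := (hL i (φ k) x (D j)).trans hLj
    have h2 := (hL i (φ l) x (D j)).trans hLj
    have h3 := hN k hk l hl
    rw [Real.dist_eq] at h3 ⊢
    rw [abs_le] at h1 h2
    rw [abs_lt] at h3 ⊢
    constructor <;> linarith [h1.1, h1.2, h2.1, h2.2, h3.1, h3.2]
  choose l hl using fun i x => cauchySeq_tendsto_of_complete (hcau i x)
  exact ⟨φ, hφ, l, hl⟩

/-- Rellich compactness for test functions with bounded gradients. -/
theorem exists_subseq_tendsto_eLpNorm {n : ℕ} (hn : 0 < n)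
    {Ω : Set (EuclideanSpace ℝ (Fin n))} (hΩ : Bornology.IsBounded Ω) {p : ℝ} (hp : 1 ≤ p)
    {η : ℕ → EuclideanSpace ℝ (Fin n) → ℝ} (hη : ∀ k, IsTestFunction Ω (η k)) {M : ℝ≥0∞}
    (hM : M ≠ ⊤) (hg : ∀ k, eLpNorm (gradient (η k)) (ENNReal.ofReal p) volume ≤ M) :
    ∃ φ : ℕ → ℕ, StrictMono φ ∧ ∃ u : EuclideanSpace ℝ (Fin n) → ℝ,
      MemLp u (ENNReal.ofReal p) (volume.restrict Ω) ∧
      Tendsto (fun k => eLpNorm (η (φ k) - u) (ENNReal.ofReal p) (volume.restrict Ω))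
        atTop (𝓝 0) := by
  have hp' : 1 ≤ ENNReal.ofReal p := by simpa using hp
  have hp0 : 0 < p := by linarith
  have : IsFiniteMeasure (volume.restrict Ω) := ⟨by simpa using hΩ.measure_lt_top⟩
  -- The gradients are supported in `Ω`, which has finite measure, so the L^p bound yields an L¹
  -- bound; this is all that the pointwise and Lipschitz estimates of the averages require.
  obtain ⟨M₁, hM₁, hg₁⟩ : ∃ M₁ : ℝ≥0∞, M₁ ≠ ⊤ ∧
      ∀ k, eLpNorm (gradient (η k)) 1 volume ≤ M₁ := by
    obtain ⟨c, hc, hle⟩ := exists_eLpNorm_le_mul_of_exponent_le (volume.restrict Ω)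
      (EuclideanSpace ℝ (Fin n)) le_rfl hp'
    refine ⟨M * c, ENNReal.mul_ne_top hM hc, fun k => ?_⟩
    have hs := (hη k).support_gradient_subset
    rw [← eLpNorm_restrict_eq_of_support_subset hs]
    refine (hle _ (((hη k).memLp_gradient 1).restrict Ω).aestronglyMeasurable).trans ?_
    gcongr
    rw [eLpNorm_restrict_eq_of_support_subset hs]
    exact hg k
  obtain ⟨v, hv⟩ := exists_forall_add_notMem hn hΩ
  have hη₁ : ∀ k, eLpNorm (η k) 1 volume ≤ ‖v‖ₑ * M₁ := fun k => by
    have := (hη k).eLpNorm_le_mul_eLpNorm_gradient le_rfl hv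
    rw [ENNReal.ofReal_one] at this
    exact this.trans (by gcongr; exact hg₁ k)
  choose ν c hνp hc hνc hνε using fun i : ℕ =>
    exists_isProbabilityMeasure_le_smul_volume n (ε := 1 / ((i : ℝ) + 1)) (by positivity)
  have hb : ∀ i k x, ‖translateAverage (ν i) (η k) x‖ₑ ≤ c i * (‖v‖ₑ * M₁) := fun i k x =>
    (enorm_translateAverage_le (hνc i) _ x).trans (by gcongr; exact hη₁ k)
  have hbt : ∀ i, c i * (‖v‖ₑ * M₁) ≠ ⊤ := fun i =>
    ENNReal.mul_ne_top (hc i) (ENNReal.mul_ne_top enorm_ne_top hM₁)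
  have hb' : ∀ i k x, |translateAverage (ν i) (η k) x| ≤ (c i * (‖v‖ₑ * M₁)).toReal :=
    fun i k x => by
      rw [← Real.norm_eq_abs, ← toReal_enorm]
      exact ENNReal.toReal_mono (hbt i) (hb i k x)
  have hL : ∀ i k x y, |translateAverage (ν i) (η k) x - translateAverage (ν i) (η k) y|
      ≤ (c i * M₁).toReal * dist x y := fun i k x y => by
    rw [← Real.norm_eq_abs, ← toReal_enorm, dist_eq_norm, ← toReal_enorm (x - y),
      ← ENNReal.toReal_mul]
    refine ENNReal.toReal_mono (ENNReal.mul_ne_top (ENNReal.mul_ne_top (hc i) hM₁) enorm_ne_top)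
      (((hη k).enorm_translateAverage_sub_le (hνc i) x y).trans ?_)
    gcongr
    exact hg₁ k
  obtain ⟨φ, hφ, l, hl⟩ := exists_subseq_tendsto_of_lipschitz hb' hL
  have hmeas : ∀ i k, AEStronglyMeasurable (translateAverage (ν i) (η k))
      (volume.restrict Ω) := fun i k => by
    have : LipschitzWith (c i * M₁).toNNReal (translateAverage (ν i) (η k)) :=
      LipschitzWith.of_dist_le_mul fun x y => by
        rw [Real.dist_eq]
        exact hL i k x y
    exact this.continuous.aestronglyMeasurable
  have hbl : ∀ i x, ‖l i x‖ₑ ≤ c i * (‖v‖ₑ * M₁) := fun i x =>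
    le_of_tendsto (hl i x).enorm (Eventually.of_forall fun k => hb i _ x)
  have hlim : ∀ i, Tendsto (fun k => eLpNorm (translateAverage (ν i) (η (φ k)) - l i)
      (ENNReal.ofReal p) (volume.restrict Ω)) atTop (𝓝 0) := fun i =>
    tendsto_eLpNorm_of_bounded hp0 (fun k => hmeas i _)
      (ENNReal.add_ne_top.2 ⟨hbt i, hbt i⟩)
      (fun k x => enorm_sub_le.trans (add_le_add (hb i _ x) (hbl i x))) (hl i)
  have hlm : ∀ i, AEStronglyMeasurable (l i) (volume.restrict Ω) := fun i =>
    aestronglyMeasurable_of_tendsto_ae atTop (fun k => hmeas i (φ k))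
      (Eventually.of_forall (hl i))
  have happ : ∀ i k, eLpNorm (translateAverage (ν i) (η k) - η k) (ENNReal.ofReal p)
      (volume.restrict Ω) ≤ ENNReal.ofReal (1 / ((i : ℝ) + 1)) * M := fun i k => by
    refine (eLpNorm_mono_measure _ Measure.restrict_le_self).trans
      (((hη k).eLpNorm_translateAverage_sub_le hp (hνε i)).trans ?_)
    gcongr
    exact hg k
  have hmem : ∀ k, MemLp (η k) (ENNReal.ofReal p) (volume.restrict Ω) := fun k =>
    ((hη k).memLp _).restrict Ω
  have hsmall : Tendsto (fun i : ℕ => ENNReal.ofReal (1 / ((i : ℝ) + 1)) * M) atTop (𝓝 0) := by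
    have h1 := ENNReal.tendsto_ofReal (tendsto_one_div_add_atTop_nhds_zero_nat (𝕜 := ℝ))
    simpa using ENNReal.Tendsto.mul_const h1 (Or.inr hM)
  refine ⟨φ, hφ, exists_memLp_tendsto_of_cauchy hp' (fun k => hmem (φ k)) fun ε hε => ?_⟩
  have hε4 : (0 : ℝ≥0∞) < ENNReal.ofReal (ε / 4) := ENNReal.ofReal_pos.2 (by positivity)
  -- The radius is fixed first, making the averaging error less than ε/4 for all `k` at once. Only
  -- then is `N` chosen, from the convergence of the averages at that radius.
  obtain ⟨i, hi⟩ := (hsmall.eventually (gt_mem_nhds hε4)).exists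
  obtain ⟨N, hN⟩ := eventually_atTop.1 ((hlim i).eventually (gt_mem_nhds hε4))
  have hone : ∀ k ≥ N, eLpNorm (η (φ k) - l i) (ENNReal.ofReal p) (volume.restrict Ω)
      < ENNReal.ofReal (ε / 2) := fun k hk => by
    have e : η (φ k) - l i = (η (φ k) - translateAverage (ν i) (η (φ k)))
        + (translateAverage (ν i) (η (φ k)) - l i) := by abel
    have e2 : ENNReal.ofReal (ε / 2) = ENNReal.ofReal (ε / 4) + ENNReal.ofReal (ε / 4) := by
      rw [← ENNReal.ofReal_add (by positivity) (by positivity)]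
      ring_nf
    rw [e, e2]
    refine (eLpNorm_add_le ((hmem _).aestronglyMeasurable.sub (hmeas i _))
      ((hmeas i _).sub (hlm i)) hp').trans_lt (ENNReal.add_lt_add ?_ (hN k hk))
    rw [eLpNorm_sub_comm]
    exact (happ i _).trans_lt hi
  refine ⟨N, fun k hk m hm => ?_⟩
  have e : η (φ k) - η (φ m) = (η (φ k) - l i) - (η (φ m) - l i) := by abel
  have e2 : ENNReal.ofReal ε = ENNReal.ofReal (ε / 2) + ENNReal.ofReal (ε / 2) := by
    rw [← ENNReal.ofReal_add (by positivity) (by positivity)]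
    ring_nf
  rw [e, e2]
  exact (eLpNorm_sub_le ((hmem _).aestronglyMeasurable.sub (hlm i))
    ((hmem _).aestronglyMeasurable.sub (hlm i)) hp').trans_lt
    (ENNReal.add_lt_add (hone k hk) (hone m hm))

/-- Rellich compactness in `W₀^{1,p}`. -/
theorem exists_subseq_tendsto_of_mem_sobolevSpaceZero {n : ℕ} (hn : 0 < n)
    {Ω : Set (EuclideanSpace ℝ (Fin n))} (hΩo : IsOpen Ω) (hΩ : Bornology.IsBounded Ω) {p : ℝ}
    (hp : 1 ≤ p) {w : ℕ → EuclideanSpace ℝ (Fin n) → ℝ}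
    {g : ℕ → EuclideanSpace ℝ (Fin n) → EuclideanSpace ℝ (Fin n)}
    (hw : ∀ k, w k ∈ sobolevSpaceZero p Ω) (hwg : ∀ k, HasWeakGradient Ω (w k) (g k)) {M : ℝ≥0∞}
    (hM : M ≠ ⊤) (hg : ∀ k, eLpNorm (g k) (ENNReal.ofReal p) (volume.restrict Ω) ≤ M) :
    ∃ φ : ℕ → ℕ, StrictMono φ ∧ ∃ u : EuclideanSpace ℝ (Fin n) → ℝ,
      MemLp u (ENNReal.ofReal p) (volume.restrict Ω) ∧
      Tendsto (fun k => eLpNorm (w (φ k) - u) (ENNReal.ofReal p) (volume.restrict Ω))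
        atTop (𝓝 0) := by
  have hp' : 1 ≤ ENNReal.ofReal p := by simpa using hp
  have hε : ∀ k : ℕ, (0 : ℝ≥0∞) < ENNReal.ofReal (1 / ((k : ℝ) + 1)) := fun k =>
    ENNReal.ofReal_pos.2 (by positivity)
  have hεt : Tendsto (fun k : ℕ => ENNReal.ofReal (1 / ((k : ℝ) + 1))) atTop (𝓝 0) := by
    simpa using ENNReal.tendsto_ofReal (tendsto_one_div_add_atTop_nhds_zero_nat (𝕜 := ℝ))
  -- Test functions within 1/(k + 1) of `w k` in both norms inherit the gradient bound up to 1, and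
  -- the distance to `w k` vanishes along any subsequence.
  choose η h3 h4 h5 using fun k => exists_isTestFunction_eLpNorm_sub_lt hΩo (hw k) (hwg k) (hε k)
  have hgm : ∀ k, MemLp (g k) (ENNReal.ofReal p) (volume.restrict Ω) := fun k =>
    memLp_of_mem_sobolevSpaceZero hΩo (hw k) (hwg k)
  have hwm : ∀ k, MemLp (w k) (ENNReal.ofReal p) (volume.restrict Ω) := fun k =>
    ((mem_sobolevSpaceZero_iff hΩo).1 (hw k)).1
  have hηg : ∀ k, eLpNorm (gradient (η k)) (ENNReal.ofReal p) volume ≤ M + 1 := fun k => by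
    rw [← eLpNorm_restrict_eq_of_support_subset (h3 k).support_gradient_subset]
    have e : gradient (η k) = g k - (g k - gradient (η k)) := by abel
    rw [e]
    refine (eLpNorm_sub_le (hgm k).aestronglyMeasurable ((hgm k).sub
      (((h3 k).memLp_gradient _).restrict Ω)).aestronglyMeasurable hp').trans
      (add_le_add (hg k) ((h5 k).le.trans ?_))
    rw [← ENNReal.ofReal_one]
    refine ENNReal.ofReal_le_ofReal (div_le_one_of_le₀ ?_ (by positivity))
    linarith [Nat.cast_nonneg (α := ℝ) k]
  obtain ⟨φ, hφ, u, hu, hul⟩ := exists_subseq_tendsto_eLpNorm hn hΩ hp h3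
    (ENNReal.add_ne_top.2 ⟨hM, ENNReal.one_ne_top⟩) hηg
  have hsum := (hεt.comp hφ.tendsto_atTop).add hul
  rw [add_zero] at hsum
  refine ⟨φ, hφ, u, hu, ?_⟩
  refine tendsto_of_tendsto_of_tendsto_of_le_of_le tendsto_const_nhds
    hsum (fun _ => zero_le) fun k => ?_
  have e : w (φ k) - u = (w (φ k) - η (φ k)) + (η (φ k) - u) := by abel
  rw [e]
  refine (eLpNorm_add_le ((hwm _).sub (((h3 _).memLp _).restrict Ω)).aestronglyMeasurable
    ((((h3 _).memLp _).restrict Ω).sub hu).aestronglyMeasurable hp').trans ?_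
  exact add_le_add (h4 _).le le_rfl

/-! ### The energy in terms of L^p norms -/

section Energy

variable {n : ℕ} {Ω : Set (EuclideanSpace ℝ (Fin n))} {v : EuclideanSpace ℝ (Fin n) → ℝ}
  {G H : EuclideanSpace ℝ (Fin n) → EuclideanSpace ℝ (Fin n)} {p q : ℝ}

theorem posPart_sub_negPart (v : EuclideanSpace ℝ (Fin n) → ℝ) :
    ((fun y => max (v y) 0) - fun y => -min (v y) 0) = v := by
  funext y
  simp only [Pi.sub_apply, sub_neg_eq_add, max_add_min, add_zero]

theorem HasWeakGradient.exists_posPart (hΩ : IsOpen Ω) (h : HasWeakGradient Ω v G) :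
    HasWeakGradient Ω (fun y => max (v y) 0) (weakGradient Ω fun y => max (v y) 0) :=
  hasWeakGradient_weakGradient (h.posPart hΩ)

theorem HasWeakGradient.exists_negPart (hΩ : IsOpen Ω) (h : HasWeakGradient Ω v G) :
    HasWeakGradient Ω (fun y => -min (v y) 0) (weakGradient Ω fun y => -min (v y) 0) := by
  have e : (fun y => -min (v y) 0) = fun y => max ((-v) y) 0 := by
    funext y
    simp [← max_neg_neg]
  rw [e]
  exact hasWeakGradient_weakGradient (h.neg.posPart hΩ)

/-- Uniqueness almost everywhere frees the energy from the chosen representative, so it can be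
computed with gradients obtained as limits. -/
theorem energy_eq (hΩ : IsOpen Ω) (hp : 0 < p) (hq : 0 < q)
    (hG : HasWeakGradient Ω (fun y => max (v y) 0) G)
    (hH : HasWeakGradient Ω (fun y => -min (v y) 0) H) :
    energy p q v Ω = eLpNorm G (ENNReal.ofReal p) (volume.restrict Ω) ^ p
      + eLpNorm H (ENNReal.ofReal q) (volume.restrict Ω) ^ q := by
  rw [eLpNorm_ofReal_rpow hp, eLpNorm_ofReal_rpow hq, ← lintegral_add_left'
    ((hG.locallyIntegrableOn_grad.aestronglyMeasurable.enorm).pow_const p), energy]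
  refine lintegral_congr_ae ?_
  filter_upwards [hG.weakGradient_ae_eq hΩ, hH.weakGradient_ae_eq hΩ] with x h1 h2
  rw [h1, h2]

theorem eLpNorm_rpow_eq_ofReal {α F : Type*} [MeasurableSpace α] {μ : Measure α}
    [NormedAddCommGroup F] {p : ℝ} (hp : 1 < p) {f : α → F}
    (hf : MemLp f (ENNReal.ofReal p) μ) :
    eLpNorm f (ENNReal.ofReal p) μ ^ p = ENNReal.ofReal (∫ x, ‖f x‖ ^ p ∂μ) := by
  have h0 : 0 ≤ ∫ x, ‖f x‖ ^ p ∂μ := integral_nonneg fun x => by positivity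
  rw [eLpNorm_eq_ofReal_integral hp hf,
    ENNReal.ofReal_rpow_of_nonneg (Real.rpow_nonneg h0 _) (by linarith), ← Real.rpow_mul h0,
    inv_mul_cancel₀ (by linarith), Real.rpow_one]

end Energy

theorem tendsto_eLpNorm_of_tendsto_eLpNorm_sub {α F : Type*} [MeasurableSpace α]
    {μ : Measure α} [NormedAddCommGroup F] {p : ℝ≥0∞} (hp : 1 ≤ p) {f : ℕ → α → F} {g : α → F}
    (hf : ∀ k, MemLp (f k) p μ) (hg : MemLp g p μ)
    (h : Tendsto (fun k => eLpNorm (f k - g) p μ) atTop (𝓝 0)) :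
    Tendsto (fun k => eLpNorm (f k) p μ) atTop (𝓝 (eLpNorm g p μ)) := by
  have : Fact (1 ≤ p) := ⟨hp⟩
  have := ((Lp.tendsto_Lp_iff_tendsto_eLpNorm'' f hf g hg).2 h).enorm
  simpa only [Lp.enorm_toLp] using this

/-! ### The relaxed convex problem and lower semicontinuity -/

section Existence

variable {n : ℕ} {Ω : Set (EuclideanSpace ℝ (Fin n))} {p q m : ℝ}

/-- Quadruples of functions: candidates for the positive and negative parts of a function and
for their gradients. -/
abbrev PhaseQuadruple (n : ℕ) : Type :=
  (EuclideanSpace ℝ (Fin n) → ℝ) × (EuclideanSpace ℝ (Fin n) → ℝ) ×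
    (EuclideanSpace ℝ (Fin n) → EuclideanSpace ℝ (Fin n)) ×
      (EuclideanSpace ℝ (Fin n) → EuclideanSpace ℝ (Fin n))

/-- The quadruples with finite energy whose first two entries differ by a function with boundary
values `φ`. -/
structure IsAdmissibleQuadruple (p q m : ℝ) (Ω : Set (EuclideanSpace ℝ (Fin n)))
    (φ : EuclideanSpace ℝ (Fin n) → ℝ) (z : PhaseQuadruple n) : Prop where
  hasWeakGradient_fst : HasWeakGradient Ω z.1 z.2.2.1
  hasWeakGradient_snd : HasWeakGradient Ω z.2.1 z.2.2.2
  memLp_fst : MemLp z.2.2.1 (ENNReal.ofReal p) (volume.restrict Ω)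
  memLp_snd : MemLp z.2.2.2 (ENNReal.ofReal q) (volume.restrict Ω)
  sub_mem : z.1 - z.2.1 - φ ∈ sobolevSpaceZero m Ω

theorem convex_isAdmissibleQuadruple (hΩ : IsOpen Ω) (hm : 1 ≤ m)
    (φ : EuclideanSpace ℝ (Fin n) → ℝ) :
    Convex ℝ {z : PhaseQuadruple n | IsAdmissibleQuadruple p q m Ω φ z} := by
  rintro z hz w hw a b - - hab
  refine ⟨(hz.hasWeakGradient_fst.const_smul a).add (hw.hasWeakGradient_fst.const_smul b),
    (hz.hasWeakGradient_snd.const_smul a).add (hw.hasWeakGradient_snd.const_smul b),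
    (hz.memLp_fst.const_smul a).add (hw.memLp_fst.const_smul b),
    (hz.memLp_snd.const_smul a).add (hw.memLp_snd.const_smul b), ?_⟩
  have e : (a • z + b • w).1 - (a • z + b • w).2.1 - φ
      = a • (z.1 - z.2.1 - φ) + b • (w.1 - w.2.1 - φ) := by
    have h1 : φ = a • φ + b • φ := by rw [← add_smul, hab, one_smul]
    simp only [Prod.fst_add, Prod.snd_add, Prod.smul_fst, Prod.smul_snd, smul_sub]
    nth_rewrite 1 [h1]
    abel
  rw [e]
  exact add_mem_sobolevSpaceZero hΩ hm (const_smul_mem_sobolevSpaceZero hΩ hz.sub_mem a)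
    (const_smul_mem_sobolevSpaceZero hΩ hw.sub_mem b)

/-- Balls in `L^p` are convex. -/
theorem convex_eLpNorm_sub_le {α F : Type*} [MeasurableSpace α] {μ : Measure α}
    [NormedAddCommGroup F] [NormedSpace ℝ F] {p : ℝ≥0∞} (hp : 1 ≤ p) (g : α → F) (δ : ℝ≥0∞) :
    Convex ℝ {f : α → F | AEStronglyMeasurable (f - g) μ ∧ eLpNorm (f - g) p μ ≤ δ} := by
  rintro f ⟨hf, hf'⟩ f' ⟨hg, hg'⟩ a b ha hb hab
  have e : a • f + b • f' - g = a • (f - g) + b • (f' - g) := by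
    have h1 : g = a • g + b • g := by rw [← add_smul, hab, one_smul]
    nth_rewrite 1 [h1]
    rw [smul_sub, smul_sub]
    abel
  refine ⟨by rw [e]; exact (hf.const_smul a).add (hg.const_smul b), ?_⟩
  rw [e]
  refine (eLpNorm_add_le (hf.const_smul a) (hg.const_smul b) hp).trans ?_
  rw [eLpNorm_const_smul, eLpNorm_const_smul, Real.enorm_of_nonneg ha, Real.enorm_of_nonneg hb]
  calc ENNReal.ofReal a * eLpNorm (f - g) p μ + ENNReal.ofReal b * eLpNorm (f' - g) p μ
      ≤ ENNReal.ofReal a * δ + ENNReal.ofReal b * δ := by gcongr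
    _ = δ := by rw [← add_mul, ← ENNReal.ofReal_add ha hb, hab, ENNReal.ofReal_one, one_mul]

/-- The energy of a quadruple. -/
noncomputable def quadrupleEnergy (p q : ℝ) (Ω : Set (EuclideanSpace ℝ (Fin n)))
    (z : PhaseQuadruple n) : ℝ :=
  (∫ x in Ω, ‖z.2.2.1 x‖ ^ p) + ∫ x in Ω, ‖z.2.2.2 x‖ ^ q

theorem quadrupleEnergy_nonneg (z : PhaseQuadruple n) : 0 ≤ quadrupleEnergy p q Ω z :=
  add_nonneg (integral_nonneg fun _ => by positivity) (integral_nonneg fun _ => by positivity)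

/-- The convexity gap of the energy splits into the two integrated defects. Both are nonnegative, so
a small gap makes each of them small. -/
theorem quadrupleEnergy_midpoint (hp : 1 < p) (hq : 1 < q) {φ : EuclideanSpace ℝ (Fin n) → ℝ}
    {z w : PhaseQuadruple n} (hz : IsAdmissibleQuadruple p q m Ω φ z)
    (hw : IsAdmissibleQuadruple p q m Ω φ w) :
    (quadrupleEnergy p q Ω z + quadrupleEnergy p q Ω w) / 2
        - quadrupleEnergy p q Ω ((1 / 2 : ℝ) • (z + w))
      = (∫ x in Ω, midpointDefect p (z.2.2.1 x) (w.2.2.1 x))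
        + ∫ x in Ω, midpointDefect q (z.2.2.2 x) (w.2.2.2 x) := by
  rw [integral_midpointDefect hp hz.memLp_fst hw.memLp_fst,
    integral_midpointDefect hq hz.memLp_snd hw.memLp_snd]
  simp only [quadrupleEnergy, Prod.smul_snd, Prod.snd_add, Prod.smul_fst, Prod.fst_add]
  ring

theorem ofReal_quadrupleEnergy (hp : 1 < p) (hq : 1 < q) {φ : EuclideanSpace ℝ (Fin n) → ℝ}
    {z : PhaseQuadruple n} (hz : IsAdmissibleQuadruple p q m Ω φ z) :
    ENNReal.ofReal (quadrupleEnergy p q Ω z)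
      = eLpNorm z.2.2.1 (ENNReal.ofReal p) (volume.restrict Ω) ^ p
        + eLpNorm z.2.2.2 (ENNReal.ofReal q) (volume.restrict Ω) ^ q := by
  rw [eLpNorm_rpow_eq_ofReal hp hz.memLp_fst, eLpNorm_rpow_eq_ofReal hq hz.memLp_snd,
    ← ENNReal.ofReal_add (integral_nonneg fun _ => by positivity)
      (integral_nonneg fun _ => by positivity), quadrupleEnergy]

/-- Lower semicontinuity and closedness: a sequence of functions converging in `L^m` with bounded
energies and fixed boundary values has an admissible limit with no larger energy. -/
theorem energy_le_of_tendsto (hΩ : IsOpen Ω) (hΩm : volume Ω ≠ ⊤) (hp : 1 < p) (hq : 1 < q)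
    (hm : 1 ≤ m) (hmp : m ≤ p) (hmq : m ≤ q) {φ : EuclideanSpace ℝ (Fin n) → ℝ}
    (hφ : φ ∈ sobolevSpace m Ω)
    {v : ℕ → EuclideanSpace ℝ (Fin n) → ℝ} {u : EuclideanSpace ℝ (Fin n) → ℝ}
    (hv : ∀ k, IsAdmissibleQuadruple p q m Ω φ ((fun y => max (v k y) 0), (fun y => -min (v k y) 0),
      weakGradient Ω (fun y => max (v k y) 0), weakGradient Ω (fun y => -min (v k y) 0)))
    (hu : MemLp u (ENNReal.ofReal m) (volume.restrict Ω))
    (hvu : Tendsto (fun k => eLpNorm (v k - u) (ENNReal.ofReal m) (volume.restrict Ω))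
      atTop (𝓝 0))
    {B : ℕ → ℝ} {I : ℝ} (hB : Tendsto B atTop (𝓝 I)) {b : ℝ} (hb : ∀ k, B k ≤ b)
    (hvB : ∀ k, quadrupleEnergy p q Ω ((fun y => max (v k y) 0), (fun y => -min (v k y) 0),
      weakGradient Ω (fun y => max (v k y) 0), weakGradient Ω (fun y => -min (v k y) 0)) ≤ B k) :
    u - φ ∈ sobolevSpaceZero m Ω ∧ energy p q u Ω ≤ ENNReal.ofReal I := by
  have : IsFiniteMeasure (volume.restrict Ω) := ⟨by simpa using hΩm.lt_top⟩
  have hp' : 1 ≤ ENNReal.ofReal p := by simpa using hp.le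
  have hq' : 1 ≤ ENNReal.ofReal q := by simpa using hq.le
  have hm' : 1 ≤ ENNReal.ofReal m := by simpa using hm
  have hmp' := ENNReal.ofReal_le_ofReal hmp
  have hmq' := ENNReal.ofReal_le_ofReal hmq
  set x : ℕ → PhaseQuadruple n := fun k => ((fun y => max (v k y) 0), (fun y => -min (v k y) 0),
    weakGradient Ω (fun y => max (v k y) 0), weakGradient Ω (fun y => -min (v k y) 0)) with hx
  -- Elements of these hulls no longer consist of the positive and negative parts of one function,
  -- but they stay admissible since admissibility is a convex condition.
  set C : ℕ → Set (PhaseQuadruple n) := fun K => convexHull ℝ (x '' Set.Ici K) with hC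
  have hadm : ∀ {K z}, z ∈ C K → IsAdmissibleQuadruple p q m Ω φ z := fun {K z} hz => by
    refine convexHull_min ?_ (convex_isAdmissibleQuadruple (p := p) (q := q) hΩ hm φ) hz
    rintro _ ⟨k, -, rfl⟩
    exact hv k
  set up : EuclideanSpace ℝ (Fin n) → ℝ := fun y => max (u y) 0 with hup
  set un : EuclideanSpace ℝ (Fin n) → ℝ := fun y => -min (u y) 0 with hun
  have hupm : MemLp up (ENNReal.ofReal m) (volume.restrict Ω) := hu.pos_part
  have hunm : MemLp un (ENNReal.ofReal m) (volume.restrict Ω) := by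
    have e : un = up - u := by
      rw [← posPart_sub_negPart u]
      simp [hup, hun]
    rw [e]
    exact hupm.sub hu
  obtain ⟨z, hzC, hzB, hzd⟩ := exists_seq_of_antitone_convex (C := C)
    (fun K L hKL => convexHull_mono (Set.image_mono (Set.Ici_subset_Ici.2 hKL)))
    (fun K => convex_convexHull ℝ _) (Φ := quadrupleEnergy p q Ω)
    (fun z _ => quadrupleEnergy_nonneg z) (B := B)
    (fun k => ⟨x k, subset_convexHull ℝ _ ⟨k, Set.mem_Ici.2 le_rfl, rfl⟩, hvB k⟩) hb
  have hz := fun k => hadm (hzC k)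
  have hzb : ∀ k, quadrupleEnergy p q Ω (z k) ≤ b + 1 := fun k => by
    refine (hzB k).trans (add_le_add (hb k) (div_le_one_of_le₀ ?_ (by positivity)))
    linarith [Nat.cast_nonneg (α := ℝ) k]
  have hdef : ∀ ε > 0, ∃ N, ∀ k ≥ N, ∀ l ≥ N,
      (∫ x in Ω, midpointDefect p ((z k).2.2.1 x) ((z l).2.2.1 x)) < ε ∧
      (∫ x in Ω, midpointDefect q ((z k).2.2.2 x) ((z l).2.2.2 x)) < ε := fun ε hε => by
    obtain ⟨N, hN⟩ := hzd ε hε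
    refine ⟨N, fun k hk l hl => ?_⟩
    have h1 := hN k hk l hl
    rw [quadrupleEnergy_midpoint hp hq (hz k) (hz l)] at h1
    have h2 : 0 ≤ ∫ x in Ω, midpointDefect p ((z k).2.2.1 x) ((z l).2.2.1 x) :=
      integral_nonneg fun _ => midpointDefect_nonneg hp.le _ _
    have h3 : 0 ≤ ∫ x in Ω, midpointDefect q ((z k).2.2.2 x) ((z l).2.2.2 x) :=
      integral_nonneg fun _ => midpointDefect_nonneg hq.le _ _
    constructor <;> linarith
  obtain ⟨G, hG, hGl⟩ := exists_memLp_tendsto_of_midpointDefect hp (fun k => (hz k).memLp_fst)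
    (B := b + 1) (fun k => le_trans (le_add_of_nonneg_right
      (integral_nonneg fun _ => by positivity)) (hzb k))
    (fun ε hε => (hdef ε hε).imp fun N hN k hk l hl => (hN k hk l hl).1)
  obtain ⟨H, hH, hHl⟩ := exists_memLp_tendsto_of_midpointDefect hq (fun k => (hz k).memLp_snd)
    (B := b + 1) (fun k => le_trans (le_add_of_nonneg_left
      (integral_nonneg fun _ => by positivity)) (hzb k))
    (fun ε hε => (hdef ε hε).imp fun N hN k hk l hl => (hN k hk l hl).2)
  have hvm : ∀ k, AEStronglyMeasurable (v k) (volume.restrict Ω) := fun k => by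
    rw [← posPart_sub_negPart (v k)]
    exact ((hv k).hasWeakGradient_fst.locallyIntegrableOn.sub
      (hv k).hasWeakGradient_snd.locallyIntegrableOn).aestronglyMeasurable
  have hzlim : Tendsto (fun k => eLpNorm ((z k).1 - up) (ENNReal.ofReal m) (volume.restrict Ω))
        atTop (𝓝 0) ∧
      Tendsto (fun k => eLpNorm ((z k).2.1 - un) (ENNReal.ofReal m) (volume.restrict Ω))
        atTop (𝓝 0) := by
    -- A product of L^m balls around u⁺ and u⁻ is convex, so it contains the hull of a tail as soon
    -- as it contains the tail. The tail enters it because truncation is 1-Lipschitz. Measurability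
    -- is part of the convex set because the triangle inequality for L^m norms needs it.
    have key : ∀ δ > 0, ∃ N, ∀ k ≥ N,
        eLpNorm ((z k).1 - up) (ENNReal.ofReal m) (volume.restrict Ω) ≤ δ ∧
        eLpNorm ((z k).2.1 - un) (ENNReal.ofReal m) (volume.restrict Ω) ≤ δ := fun δ hδ => by
      obtain ⟨N, hN⟩ := (ENNReal.tendsto_atTop_zero.1 hvu) δ hδ
      refine ⟨N, fun k hk => ?_⟩
      have hconv : Convex ℝ {z : PhaseQuadruple n |
          (AEStronglyMeasurable (z.1 - up) (volume.restrict Ω) ∧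
            eLpNorm (z.1 - up) (ENNReal.ofReal m) (volume.restrict Ω) ≤ δ) ∧
          (AEStronglyMeasurable (z.2.1 - un) (volume.restrict Ω) ∧
            eLpNorm (z.2.1 - un) (ENNReal.ofReal m) (volume.restrict Ω) ≤ δ)} := by
        refine Convex.inter (s := {z : PhaseQuadruple n |
          AEStronglyMeasurable (z.1 - up) (volume.restrict Ω) ∧
            eLpNorm (z.1 - up) (ENNReal.ofReal m) (volume.restrict Ω) ≤ δ}) ?_ ?_
        · exact (convex_eLpNorm_sub_le hm' up δ).linear_preimage (LinearMap.fst ℝ _ _)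
        · exact (convex_eLpNorm_sub_le hm' un δ).linear_preimage
            ((LinearMap.fst ℝ _ _).comp (LinearMap.snd ℝ _ _))
      have hmem := convexHull_min (s := x '' Set.Ici N) ?_ hconv
        (convexHull_mono (Set.image_mono (Set.Ici_subset_Ici.2 hk)) (hzC k))
      · exact ⟨hmem.1.2, hmem.2.2⟩
      · rintro _ ⟨l, hl, rfl⟩
        refine ⟨⟨((hv l).hasWeakGradient_fst.locallyIntegrableOn.aestronglyMeasurable).sub
          hupm.aestronglyMeasurable, (eLpNorm_mono fun y => ?_).trans (hN l hl)⟩,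
          ⟨((hv l).hasWeakGradient_snd.locallyIntegrableOn.aestronglyMeasurable).sub
          hunm.aestronglyMeasurable, (eLpNorm_mono fun y => ?_).trans (hN l hl)⟩⟩
        · exact abs_max_sub_max_le_abs _ _ _
        · have e : (x l).2.1 y - un y = -(min (v l y) 0 - min (u y) 0) := by
            simp only [hx, hun]
            ring
          rw [Pi.sub_apply, e, norm_neg]
          exact abs_min_sub_min_le_max _ _ _ _ |>.trans (by simp)
    exact ⟨ENNReal.tendsto_atTop_zero.2 fun δ hδ => (key δ hδ).imp fun N hN k hk => (hN k hk).1,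
      ENNReal.tendsto_atTop_zero.2 fun δ hδ => (key δ hδ).imp fun N hN k hk => (hN k hk).2⟩
  -- The function entries tend to u⁺ and u⁻ in L^m, the gradient entries in L^p and L^q, which makes
  -- the strong limits `G` and `H` the weak gradients of u⁺ and u⁻.
  have hwG : HasWeakGradient Ω up G := hasWeakGradient_of_tendsto_eLpNorm hm' hp'
    (fun k => (hz k).hasWeakGradient_fst) (MemLp.locallyIntegrableOn hm' hΩ hupm)
    (MemLp.locallyIntegrableOn hp' hΩ hG) hzlim.1 hGl
  have hwH : HasWeakGradient Ω un H := hasWeakGradient_of_tendsto_eLpNorm hm' hq'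
    (fun k => (hz k).hasWeakGradient_snd) (MemLp.locallyIntegrableOn hm' hΩ hunm)
    (MemLp.locallyIntegrableOn hq' hΩ hH) hzlim.2 hHl
  refine ⟨?_, ?_⟩
  · obtain ⟨hφm, Gφ, hGφ, hGφm⟩ := hφ
    have h0 : ∀ {F : Type} [NormedAddCommGroup F] {a c : ℕ → EuclideanSpace ℝ (Fin n) → F},
        (∀ k, AEStronglyMeasurable (a k) (volume.restrict Ω)) →
        (∀ k, AEStronglyMeasurable (c k) (volume.restrict Ω)) →
        Tendsto (fun k => eLpNorm (a k) (ENNReal.ofReal m) (volume.restrict Ω)) atTop (𝓝 0) →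
        Tendsto (fun k => eLpNorm (c k) (ENNReal.ofReal m) (volume.restrict Ω)) atTop (𝓝 0) →
        Tendsto (fun k => eLpNorm (a k - c k) (ENNReal.ofReal m) (volume.restrict Ω))
          atTop (𝓝 0) := fun ha hc ha' hc' => by
      have := ha'.add hc'
      rw [add_zero] at this
      exact tendsto_of_tendsto_of_tendsto_of_le_of_le tendsto_const_nhds this (fun _ => zero_le)
        fun k => eLpNorm_sub_le (ha k) (hc k) hm'
    -- As u = u⁺ - u⁻, the differences of the two function entries, minus φ, tend to u - φ. Their
    -- gradients converge in L^m because m ≤ p and m ≤ q.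
    refine mem_sobolevSpaceZero_of_tendsto hΩ hm (fun k => (hz k).sub_mem)
      (fun k => ((hz k).hasWeakGradient_fst.sub (hz k).hasWeakGradient_snd).sub hGφ)
      (hu.sub hφm) (G := G - H - Gφ)
      (((hG.mono_exponent hmp').sub (hH.mono_exponent hmq')).sub hGφm) ?_ ?_
    · have e : ∀ k, (z k).1 - (z k).2.1 - φ - (u - φ) = ((z k).1 - up) - ((z k).2.1 - un) := by
        intro k
        nth_rewrite 1 [← posPart_sub_negPart u]
        abel
      simp_rw [e]
      exact h0
        (fun k => (hz k).hasWeakGradient_fst.locallyIntegrableOn.aestronglyMeasurable.sub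
          hupm.aestronglyMeasurable)
        (fun k => (hz k).hasWeakGradient_snd.locallyIntegrableOn.aestronglyMeasurable.sub
          hunm.aestronglyMeasurable) hzlim.1 hzlim.2
    · have e : ∀ k, (z k).2.2.1 - (z k).2.2.2 - Gφ - (G - H - Gφ)
          = ((z k).2.2.1 - G) - ((z k).2.2.2 - H) := by
        intro k
        abel
      simp_rw [e]
      have m1 : ∀ k, AEStronglyMeasurable ((z k).2.2.1 - G) (volume.restrict Ω) := fun k =>
        ((hz k).memLp_fst.sub hG).aestronglyMeasurable
      have m2 : ∀ k, AEStronglyMeasurable ((z k).2.2.2 - H) (volume.restrict Ω) := fun k =>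
        ((hz k).memLp_snd.sub hH).aestronglyMeasurable
      exact h0 m1 m2 (tendsto_eLpNorm_of_exponent_le hm' hmp' m1 hGl)
        (tendsto_eLpNorm_of_exponent_le hm' hmq' m2 hHl)
  · rw [energy_eq hΩ (by linarith) (by linarith) hwG hwH]
    have t1 := ((ENNReal.continuous_rpow_const (y := p)).tendsto _).comp
      (tendsto_eLpNorm_of_tendsto_eLpNorm_sub hp' (fun k => (hz k).memLp_fst) hG hGl)
    have t2 := ((ENNReal.continuous_rpow_const (y := q)).tendsto _).comp
      (tendsto_eLpNorm_of_tendsto_eLpNorm_sub hq' (fun k => (hz k).memLp_snd) hH hHl)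
    have t3 : Tendsto (fun k : ℕ => ENNReal.ofReal (B k + 1 / ((k : ℝ) + 1))) atTop
        (𝓝 (ENNReal.ofReal I)) := by
      have := hB.add (tendsto_one_div_add_atTop_nhds_zero_nat (𝕜 := ℝ))
      rw [add_zero] at this
      exact ENNReal.tendsto_ofReal this
    refine le_of_tendsto_of_tendsto' (t1.add t2) t3 fun k => ?_
    simp only [Function.comp_apply]
    rw [← ofReal_quadrupleEnergy hp hq (hz k)]
    exact ENNReal.ofReal_le_ofReal (hzB k)

end Existence

/-! ### The direct method -/

section Existence

variable {n : ℕ} {Ω : Set (EuclideanSpace ℝ (Fin n))} {p q m : ℝ}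

/-- The union of the two spaces is the larger one, since on finite measure W₀^{1,s} shrinks as `s`
grows; the admissible class is therefore affine. -/
theorem sobolevSpaceZero_union (hΩ : IsOpen Ω) (hΩm : volume Ω ≠ ⊤) (hp : 1 ≤ p) (hq : 1 ≤ q) :
    sobolevSpaceZero p Ω ∪ sobolevSpaceZero q Ω = sobolevSpaceZero (min p q) Ω := by
  rcases le_total p q with h | h
  · rw [min_eq_left h, Set.union_eq_left]
    exact sobolevSpaceZero_subset_of_le hΩ hΩm hp h
  · rw [min_eq_right h, Set.union_eq_right]
    exact sobolevSpaceZero_subset_of_le hΩ hΩm hq h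

theorem sobolevSpace_union_subset (hΩm : volume Ω ≠ ⊤) :
    sobolevSpace p Ω ∪ sobolevSpace q Ω ⊆ sobolevSpace (min p q) Ω :=
  Set.union_subset (sobolevSpace_subset_of_le hΩm (min_le_left p q))
    (sobolevSpace_subset_of_le hΩm (min_le_right p q))

variable {φ v : EuclideanSpace ℝ (Fin n) → ℝ}

/-- This places every competitor in the scope of the truncation theorem, so that the gradients in
the energy are genuine and not the default value 0. -/
theorem exists_hasWeakGradient_of_sub_mem (hφ : φ ∈ sobolevSpace m Ω)
    (hv : v - φ ∈ sobolevSpaceZero m Ω) : ∃ G, HasWeakGradient Ω v G := by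
  obtain ⟨-, Gφ, hGφ, -⟩ := hφ
  obtain ⟨⟨-, G, hG, -⟩, -⟩ := hv
  exact ⟨G + Gφ, by simpa using hG.add hGφ⟩

theorem memLp_of_eLpNorm_rpow_lt_top {α F : Type*} [MeasurableSpace α] {μ : Measure α}
    [NormedAddCommGroup F] {p : ℝ} (hp : 0 < p) {r : ℝ≥0∞} {f : α → F}
    (hf : AEStronglyMeasurable f μ) (h : eLpNorm f r μ ^ p < ⊤) : MemLp f r μ :=
  ⟨hf, (ENNReal.rpow_lt_top_iff_of_pos hp).1 h⟩

/-- A function of finite energy with boundary values `φ` gives an admissible quadruple. -/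
theorem isAdmissibleQuadruple_of_energy_lt_top (hΩ : IsOpen Ω) (hp : 1 < p) (hq : 1 < q)
    (hφ : φ ∈ sobolevSpace m Ω) (hv : v - φ ∈ sobolevSpaceZero m Ω)
    (hE : energy p q v Ω < ⊤) :
    IsAdmissibleQuadruple p q m Ω φ ((fun y => max (v y) 0), (fun y => -min (v y) 0),
      weakGradient Ω (fun y => max (v y) 0), weakGradient Ω (fun y => -min (v y) 0)) := by
  obtain ⟨G, hG⟩ := exists_hasWeakGradient_of_sub_mem hφ hv
  have h1 := hG.exists_posPart hΩ
  have h2 := hG.exists_negPart hΩ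
  rw [energy_eq hΩ (by linarith) (by linarith) h1 h2, ENNReal.add_lt_top] at hE
  refine ⟨h1, h2, memLp_of_eLpNorm_rpow_lt_top (by linarith)
      h1.locallyIntegrableOn_grad.aestronglyMeasurable hE.1,
    memLp_of_eLpNorm_rpow_lt_top (by linarith)
      h2.locallyIntegrableOn_grad.aestronglyMeasurable hE.2, ?_⟩
  simpa only [posPart_sub_negPart] using hv

/-- A sequence of functions with boundary values `φ` and bounded energies has a subsequence that
converges in `L^m`. -/
theorem exists_subseq_tendsto_of_energy_le (hn : 0 < n) (hΩ : IsOpen Ω)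
    (hΩb : Bornology.IsBounded Ω) (hp : 1 < p) (hq : 1 < q) (hm : 1 ≤ m) (hmp : m ≤ p)
    (hmq : m ≤ q) (hφ : φ ∈ sobolevSpace m Ω) {v : ℕ → EuclideanSpace ℝ (Fin n) → ℝ}
    (hv : ∀ k, v k - φ ∈ sobolevSpaceZero m Ω) {E : ℝ≥0∞} (hE : E < ⊤)
    (hvE : ∀ k, energy p q (v k) Ω ≤ E) :
    ∃ σ : ℕ → ℕ, StrictMono σ ∧ ∃ u : EuclideanSpace ℝ (Fin n) → ℝ,
      MemLp u (ENNReal.ofReal m) (volume.restrict Ω) ∧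
      Tendsto (fun k => eLpNorm (v (σ k) - u) (ENNReal.ofReal m) (volume.restrict Ω))
        atTop (𝓝 0) := by
  have : IsFiniteMeasure (volume.restrict Ω) := ⟨by simpa using hΩb.measure_lt_top⟩
  have hm' : 1 ≤ ENNReal.ofReal m := by simpa using hm
  have hz := fun k => isAdmissibleQuadruple_of_energy_lt_top hΩ hp hq hφ (hv k)
    ((hvE k).trans_lt hE)
  obtain ⟨hφm, Gφ, hGφ, hGφm⟩ := hφ
  have hw : ∀ k, HasWeakGradient Ω (v k - φ) (weakGradient Ω (fun y => max (v k y) 0)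
      - weakGradient Ω (fun y => -min (v k y) 0) - Gφ) := fun k => by
    have := ((hz k).hasWeakGradient_fst.sub (hz k).hasWeakGradient_snd).sub hGφ
    rwa [posPart_sub_negPart] at this
  obtain ⟨c, hc, hcle⟩ := exists_eLpNorm_le_mul_of_exponent_le (volume.restrict Ω)
    (EuclideanSpace ℝ (Fin n)) hm' (ENNReal.ofReal_le_ofReal hmp)
  obtain ⟨d, hd, hdle⟩ := exists_eLpNorm_le_mul_of_exponent_le (volume.restrict Ω)
    (EuclideanSpace ℝ (Fin n)) hm' (ENNReal.ofReal_le_ofReal hmq)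
  have hpow : ∀ {r : ℝ} {t : ℝ≥0∞}, 1 < r → t ^ r ≤ E → t ≤ E ^ r⁻¹ := fun hr ht =>
    (ENNReal.le_rpow_inv_iff (by linarith)).2 ht
  have htop : ∀ {r : ℝ}, 1 < r → E ^ r⁻¹ ≠ ⊤ := fun hr =>
    ENNReal.rpow_ne_top_of_nonneg (by positivity) hE.ne
  -- The bound comes from ∇(v - φ) = ∇v⁺ - ∇v⁻ - ∇φ: the energy bounds the first two terms by
  -- E^{1/p} in L^p and E^{1/q} in L^q, and `c`, `d` are the Hölder factors down to L^m.
  obtain ⟨σ, hσ, w, hwm, hwl⟩ := exists_subseq_tendsto_of_mem_sobolevSpaceZero hn hΩ hΩb hm hv hw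
    (M := E ^ p⁻¹ * c + E ^ q⁻¹ * d + eLpNorm Gφ (ENNReal.ofReal m) (volume.restrict Ω))
    (by simpa only [ne_eq, ENNReal.add_eq_top, not_or] using
      ⟨⟨ENNReal.mul_ne_top (htop hp) hc, ENNReal.mul_ne_top (htop hq) hd⟩,
        hGφm.eLpNorm_ne_top⟩) fun k => by
      have hEk := hvE k
      rw [energy_eq hΩ (by linarith) (by linarith) (hz k).hasWeakGradient_fst
        (hz k).hasWeakGradient_snd] at hEk
      have m1 := (hz k).memLp_fst.aestronglyMeasurable
      have m2 := (hz k).memLp_snd.aestronglyMeasurable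
      refine (eLpNorm_sub_le (m1.sub m2) hGφm.aestronglyMeasurable hm').trans ?_
      gcongr
      refine (eLpNorm_sub_le m1 m2 hm').trans (add_le_add ((hcle _ m1).trans ?_)
        ((hdle _ m2).trans ?_))
      · gcongr
        exact hpow hp (le_self_add.trans hEk)
      · gcongr
        exact hpow hq (le_add_self.trans hEk)
  refine ⟨σ, hσ, w + φ, hwm.add hφm, hwl.congr fun k => ?_⟩
  congr 1
  abel

/-- Existence of minimizers of the two-phase energy with boundary values `φ`. -/
theorem exists_energy_minimizer (hn : 0 < n) (hΩ : IsOpen Ω) (hΩb : Bornology.IsBounded Ω)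
    (hp : 1 < p) (hq : 1 < q) (hm : 1 ≤ m) (hmp : m ≤ p) (hmq : m ≤ q)
    (hφ : φ ∈ sobolevSpace m Ω) (hE : energy p q φ Ω < ⊤) :
    ∃ u, u - φ ∈ sobolevSpaceZero m Ω ∧ energy p q u Ω < ⊤ ∧
      ∀ v, v - φ ∈ sobolevSpaceZero m Ω → energy p q u Ω ≤ energy p q v Ω := by
  set S : Set ℝ≥0∞ := (fun v => energy p q v Ω) '' {v | v - φ ∈ sobolevSpaceZero m Ω} with hS
  have hφS : energy p q φ Ω ∈ S := ⟨φ, by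
    rw [Set.mem_ofPred_eq, sub_self]
    exact zero_mem_sobolevSpaceZero hΩ m, rfl⟩
  -- Finiteness of the energy of φ makes the infimum finite; it can thus be approached from above
  -- through real numbers, which gives a minimizing sequence with finite energies.
  have hI : sInf S < ⊤ := (sInf_le hφS).trans_lt hE
  have hIS : ∀ v, v - φ ∈ sobolevSpaceZero m Ω → sInf S ≤ energy p q v Ω := fun v hv =>
    sInf_le ⟨v, hv, rfl⟩
  have hex : ∀ k : ℕ, ∃ v, v - φ ∈ sobolevSpaceZero m Ω ∧
      energy p q v Ω < ENNReal.ofReal ((sInf S).toReal + 1 / ((k : ℝ) + 1)) := fun k => by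
    have h1 : sInf S < ENNReal.ofReal ((sInf S).toReal + 1 / ((k : ℝ) + 1)) := by
      rw [ENNReal.lt_ofReal_iff_toReal_lt hI.ne]
      exact lt_add_of_pos_right _ (by positivity)
    obtain ⟨_, ⟨v, hv, rfl⟩, hlt⟩ := sInf_lt_iff.1 h1
    exact ⟨v, hv, hlt⟩
  choose v hv hvE using hex
  have hone : ∀ k : ℕ, 1 / ((k : ℝ) + 1) ≤ 1 := fun k =>
    div_le_one_of_le₀ (by linarith [Nat.cast_nonneg (α := ℝ) k]) (by positivity)
  obtain ⟨σ, hσ, u, hu, hul⟩ := exists_subseq_tendsto_of_energy_le hn hΩ hΩb hp hq hm hmp hmq hφ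
    hv (E := ENNReal.ofReal ((sInf S).toReal + 1)) ENNReal.ofReal_lt_top
    fun k => (hvE k).le.trans (ENNReal.ofReal_le_ofReal (by linarith [hone k]))
  have hz := fun k => isAdmissibleQuadruple_of_energy_lt_top hΩ hp hq hφ (hv k)
    ((hvE k).trans ENNReal.ofReal_lt_top)
  have hlim : Tendsto (fun k : ℕ => (sInf S).toReal + 1 / ((k : ℝ) + 1)) atTop
      (𝓝 (sInf S).toReal) := by
    simpa using (tendsto_one_div_add_atTop_nhds_zero_nat (𝕜 := ℝ)).const_add (sInf S).toReal
  have main := energy_le_of_tendsto hΩ hΩb.measure_lt_top.ne hp hq hm hmp hmq hφ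
    (fun k => hz (σ k)) hu hul (hlim.comp hσ.tendsto_atTop) (b := (sInf S).toReal + 1)
    (fun k => by
      simp only [Function.comp_apply]
      linarith [hone (σ k)]) fun k => by
      rw [Function.comp_apply, ← ENNReal.ofReal_le_ofReal_iff (by positivity),
        ofReal_quadrupleEnergy hp hq (hz (σ k)), ← energy_eq hΩ (by linarith) (by linarith)
          (hz (σ k)).hasWeakGradient_fst (hz (σ k)).hasWeakGradient_snd]
      exact (hvE (σ k)).le
  rw [ENNReal.ofReal_toReal hI.ne] at main
  exact ⟨u, main.1, main.2.trans_lt hI, fun w hw => main.2.trans (hIS w hw)⟩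

end Existence

end TwoPhase

theorem proposition3p1 (n : ℕ) (hn : 2 ≤ n) (p q : ℝ) (hp : 1 < p) (hq : 1 < q) (hpq : p ≠ q)
    (Ω : Set (EuclideanSpace ℝ (Fin n))) (hΩo : IsOpen Ω) (hΩc : IsConnected Ω)
    (hΩb : Bornology.IsBounded Ω) (φ : EuclideanSpace ℝ (Fin n) → ℝ)
    (hφ : φ ∈ TwoPhase.sobolevSpace p Ω ∪ TwoPhase.sobolevSpace q Ω)
    (hJφ : TwoPhase.energy p q φ Ω < ⊤) :
    ∃ u ∈ TwoPhase.admissibleClass p q φ Ω,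
      TwoPhase.energy p q u Ω < ⊤ ∧
      ∀ v ∈ TwoPhase.admissibleClass p q φ Ω,
        TwoPhase.energy p q u Ω ≤ TwoPhase.energy p q v Ω := by
  have hΩm : volume Ω ≠ ⊤ := hΩb.measure_lt_top.ne
  simp only [TwoPhase.admissibleClass, Set.mem_ofPred_eq,
    TwoPhase.sobolevSpaceZero_union hΩo hΩm hp.le hq.le]
  exact TwoPhase.exists_energy_minimizer (by omega) hΩo hΩb hp hq (le_min hp.le hq.le)
    (min_le_left p q) (min_le_right p q) (TwoPhase.sobolevSpace_union_subset hΩm hφ) hJφ
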